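/- For real sequences $A=(A_n)_{n\ge 0}$ and a real number $\lambda$, the Hessian operators $L_\pm$ of the conformal flow on $\mathbb S^3$ at the standing wave $A$ with frequency $\lambda$ are the operators in $\ell^2=\ell^2(\mathbb N)$, $\mathbb N=\{0,1,2,\dots\}$, taken on their maximal domain, given by $$(L_\pm a)_n=\sum_{j=0}^\infty [B_\pm]_{nj}\,a_j-(n+1)\lambda a_n,\qquad [B_\pm]_{nj}=2\sum_{k=\max(0,j-n)}^\infty S_{n,j,k,n+k-j}A_kA_{n+k-j}\pm\sum_{k=0}^{n+j}S_{n,j,k,n+j-k}A_kA_{n+j-k},$$ where $S_{n,j,k,l}=\min(n,j,k,l)+1$. For $p\in[0,1)$ let $L_\pm(p)$ be these operators at the ground state $A_n(p)=(1-p^2)p^n$, $\lambda=1$ (with $0^0=1$), and let $h^1=\{a\in\ell^2:\sum_n (n+1)^2|a_n|^2<\infty\}$. **Lemma.** Let $p\in[0,1)$, and let $\ell^2$ be the real or the complex sequence space. Then $$[B_\pm(p)]_{nj}=2p^{|n-j|}-2p^{2+n+j}\pm(1-p^2)^2(j+1)(n+1)p^{n+j}\qquad(n,j\in\mathbb N);$$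 the operators $L_\pm(p)$ have domain $h^1$, are self-adjoint, and have compact resolvent; and their spectra consist of the following isolated eigenvalues, listed with multiplicity: $$\sigma(L_-(p))=\{\dots,-3,-2,-1,0,0\},\qquad \sigma(L_+(p))=\{\dots,-3,-2,-1,0,\lambda_*(p)\},\qquad \lambda_*(p)=\frac{2(1+p^2)}{1-p^2}>0.$$ That is, $\sigma(L_-(p))=\{0,-1,-2,\dots\}$, where the eigenvalue $0$ has multiplicity $2$ and every $-m$, $m\ge1$, is simple; and $\sigma(L_+(p))=\{\lambda_*(p),0,-1,-2,\dots\}$, where every eigenvalue is simple. -/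

import Mathlib

noncomputable section

namespace ConformalFlow

/-- The Hilbert space `ℓ²(ℕ)` of square-summable sequences with values in `𝕜 = ℝ` or `ℂ`. -/
abbrev Ell2 (𝕜 : Type*) [RCLike 𝕜] : Type _ := lp (fun _ : ℕ => 𝕜) 2

/-- The weighted space `h^s`: all `a ∈ ℓ²` with `∑ (n+1)^(2s) |a_n|² < ∞`. -/
def weightedSpace (𝕜 : Type*) [RCLike 𝕜] (s : ℝ) : Set (Ell2 𝕜) :=
  {a | Summable fun n : ℕ => ((n : ℝ) + 1) ^ (2 * s) * ‖a n‖ ^ 2}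

/-- The interaction coefficients `min {n, j, k, l} + 1` of the conformal flow. -/
def interaction (n j k l : ℕ) : ℝ := ((min (min n j) (min k l) + 1 : ℕ) : ℝ)

/-- The entries of the matrices `B₊` (sign `1`) and `B₋` (sign `-1`) of the second variation at a
real stationary state `A`:
`2 ∑_{k ≥ max(0, j-n)} S_{n,j,k,n+k-j} A_k A_{n+k-j} ± ∑_{k=0}^{n+j} S_{n,j,k,n+j-k} A_k A_{n+j-k}`.
-/
def hessianEntry (s : ℤˣ) (A : ℕ → ℝ) (n j : ℕ) : ℝ :=
  2 * (∑' k : ℕ, if j ≤ n + k then interaction n j k (n + k - j) * (A k * A (n + k - j)) else 0) +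
    ((s : ℤ) : ℝ) * ∑ k ∈ Finset.range (n + j + 1),
      interaction n j k (n + j - k) * (A k * A (n + j - k))

/-- The `n`-th component `(L± a)_n = ∑_j (B±)_{nj} a_j - (n+1) λ a_n` of the Hessian operator. -/
def hessianAction {𝕜 : Type*} [RCLike 𝕜] (s : ℤˣ) (A : ℕ → ℝ) (lam : ℝ) (a : ℕ → 𝕜) (n : ℕ) : 𝕜 :=
  (∑' j : ℕ, (hessianEntry s A n j : 𝕜) * a j) - ((n : 𝕜) + 1) * (lam : 𝕜) * a n

theorem hessianAction_add {𝕜 : Type*} [RCLike 𝕜] (s : ℤˣ) (A : ℕ → ℝ) (lam : ℝ) (a b : ℕ → 𝕜)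
    (ha : ∀ n, Summable fun j => (hessianEntry s A n j : 𝕜) * a j)
    (hb : ∀ n, Summable fun j => (hessianEntry s A n j : 𝕜) * b j) :
    hessianAction s A lam (a + b) = hessianAction s A lam a + hessianAction s A lam b := by
  funext n
  simp only [hessianAction, Pi.add_apply, mul_add]
  rw [(ha n).tsum_add (hb n)]
  ring

theorem hessianAction_smul {𝕜 : Type*} [RCLike 𝕜] (s : ℤˣ) (A : ℕ → ℝ) (lam : ℝ) (c : 𝕜)
    (a : ℕ → 𝕜) :
    hessianAction s A lam (c • a) = c • hessianAction s A lam a := by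
  funext n
  have h : ∀ j, (hessianEntry s A n j : 𝕜) * (c * a j) =
      c * ((hessianEntry s A n j : 𝕜) * a j) := fun j => by ring
  simp only [hessianAction, Pi.smul_apply, smul_eq_mul, h, tsum_mul_left]
  ring

/-- The maximal domain of the Hessian operator: all `a ∈ ℓ²` for which the series defining `L± a`
converge and `L± a` is again in `ℓ²`. -/
def hessianDomain (𝕜 : Type*) [RCLike 𝕜] (s : ℤˣ) (A : ℕ → ℝ) (lam : ℝ) :
    Submodule 𝕜 (Ell2 𝕜) where
  carrier := {a | (∀ n, Summable fun j => (hessianEntry s A n j : 𝕜) * a j) ∧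
    Memℓp (hessianAction s A lam (a : ℕ → 𝕜)) 2}
  zero_mem' := by
    have h : hessianAction s A lam ((0 : Ell2 𝕜) : ℕ → 𝕜) = 0 := by
      funext n
      simp [hessianAction]
    refine ⟨fun n => by simpa using summable_zero, ?_⟩
    rw [h]
    exact zero_memℓp
  add_mem' := by
    rintro a b ⟨ha, ha'⟩ ⟨hb, hb'⟩
    refine ⟨fun n => ?_, ?_⟩
    · simpa [mul_add] using (ha n).add (hb n)
    · rw [lp.coeFn_add, hessianAction_add s A lam _ _ ha hb]
      exact ha'.add hb'
  smul_mem' := by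
    rintro c a ⟨ha, ha'⟩
    refine ⟨fun n => ?_, ?_⟩
    · simpa [mul_left_comm] using (ha n).mul_left c
    · rw [lp.coeFn_smul, hessianAction_smul]
      exact ha'.const_smul c

/-- The Hessian operator `L₊` (sign `1`) or `L₋` (sign `-1`) of a real stationary state `A` with
frequency `λ`, as an unbounded operator in `ℓ²` with its maximal domain. -/
def hessianOperator (𝕜 : Type*) [RCLike 𝕜] (s : ℤˣ) (A : ℕ → ℝ) (lam : ℝ) :
    Ell2 𝕜 →ₗ.[𝕜] Ell2 𝕜 where
  domain := hessianDomain 𝕜 s A lam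
  toFun :=
    { toFun := fun a => ⟨hessianAction s A lam ((a : Ell2 𝕜) : ℕ → 𝕜), a.2.2⟩
      map_add' := fun a b => Subtype.ext (hessianAction_add s A lam _ _ a.2.1 b.2.1)
      map_smul' := fun c a => Subtype.ext (hessianAction_smul s A lam c _) }

/-- The normalized ground state `A_n(p) = (1 - p²) pⁿ`, with frequency `λ = 1`. -/
def groundState (p : ℝ) (n : ℕ) : ℝ := (1 - p ^ 2) * p ^ n

/-- The operators `L₊(p)` (sign `1`) and `L₋(p)` (sign `-1`) at the ground state. -/
def groundHessian (𝕜 : Type*) [RCLike 𝕜] (s : ℤˣ) (p : ℝ) : Ell2 𝕜 →ₗ.[𝕜] Ell2 𝕜 :=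
  hessianOperator 𝕜 s (groundState p) 1

section Spectrum

variable {𝕜 E : Type*} [RCLike 𝕜] [NormedAddCommGroup E] [NormedSpace 𝕜 E]

/-- `R` is the resolvent of the unbounded operator `L` at `z`, i.e. a bounded everywhere defined
two-sided inverse of `L - z : dom L → E`. -/
def IsResolvent (L : E →ₗ.[𝕜] E) (z : 𝕜) (R : E →L[𝕜] E) : Prop :=
  (∀ y : E, ∃ h : R y ∈ L.domain, L ⟨R y, h⟩ - z • R y = y) ∧
    ∀ x : L.domain, R (L x - z • (x : E)) = x

/-- The spectrum of an unbounded operator: the points at which there is no bounded resolvent. -/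
def unboundedSpectrum (L : E →ₗ.[𝕜] E) : Set 𝕜 :=
  {z | ¬ ∃ R : E →L[𝕜] E, IsResolvent L z R}

/-- `L` has non-empty resolvent set and all its resolvents are compact operators. -/
def HasCompactResolvent (L : E →ₗ.[𝕜] E) : Prop :=
  (∃ (z : 𝕜) (R : E →L[𝕜] E), IsResolvent L z R) ∧
    ∀ (z : 𝕜) (R : E →L[𝕜] E), IsResolvent L z R → IsCompactOperator R

/-- The eigenspace `ker (L - z)`, as a subspace of the domain of `L`. -/
def unboundedEigenspace (L : E →ₗ.[𝕜] E) (z : 𝕜) : Submodule 𝕜 L.domain :=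
  LinearMap.ker (L.toFun - z • L.domain.subtype)

end Spectrum

end ConformalFlow

end

noncomputable section

namespace ConformalFlow

open Filter Topology
open scoped InnerProductSpace

/-! ### Unbounded operators that are diagonal in a Hilbert basis. -/

section Diagonal

variable {ι 𝕜 E : Type*} [RCLike 𝕜] [NormedAddCommGroup E] [InnerProductSpace 𝕜 E]

/-! The proof diagonalizes both operators explicitly, in one Hilbert basis. Let `N` be
multiplication by `n + 1`, `S` the right shift and `d` the sequence `(n + 1) pⁿ`. Evaluating the
sums over the ground state gives `L± = 2G ± (1 - p²)² ⟨d, ·⟩ d - N` with `G = (1 - p²)(1 - pS)⁻¹(1 -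
pS*)⁻¹`. Everything except `N` is bounded.

Read sequences as power series: `N` becomes `z d/dz + 1`, and `V = (S - p)(1 - pS)⁻¹` becomes
multiplication by `b(z) = (z - p)/(1 - pz)`, an isometry. The commutator `[N, V]` is multiplication
by `z b'(z) = (1 - p²) z/(1 - pz)²`, which is exactly `GV` (`greenOp_blaschke`,
`IsWeighted.blaschke`). Since `GV` commutes with `V`, `N V² = V² N + 2 G V²` on the standard
vectors, so `(2G - N) V² eₖ = -(k + 1) V² eₖ`. The range of `V²` consists of series with a double
zero at `p`, which `d` annihilates, so the rank-one term does not matter there.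

The orthogonal complement of that range has dimension two and is spanned by `d` and a vector
orthogonal to it (`eq_zero_of_orthogonal`). The latter is in the kernel of `L±`. On `d`, `2G - N`
and the rank-one term contribute `(1 + p²)/(1 - p²)` and plus or minus the same number: the sum is
`λ_*` for `L₊` and `0` for `L₋`.

Maximality of the domain makes `L±` the maximal diagonal operator in this basis. Self-adjointness,
compact resolvent, spectrum and multiplicities are then read off the diagonal, which tends to
infinity in modulus. -/

theorem hilbertBasis_ext (b : HilbertBasis ι 𝕜 E) {x y : E}
    (h : ∀ i, ⟪b i, x⟫_𝕜 = ⟪b i, y⟫_𝕜) : x = y := by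
  apply b.repr.injective
  ext i
  simpa only [HilbertBasis.repr_apply_apply] using h i

/-- Parseval turns domination of coordinates into domination of norms. It bounds the tails of
diagonal operators below. -/
theorem opNorm_le_of_norm_inner_le (b : HilbertBasis ι 𝕜 E) (T : E →L[𝕜] E) {C : ℝ} (hC : 0 ≤ C)
    (h : ∀ x i, ‖⟪b i, T x⟫_𝕜‖ ≤ C * ‖⟪b i, x⟫_𝕜‖) : ‖T‖ ≤ C := by
  refine T.opNorm_le_bound hC fun x => ?_
  rw [← b.repr.norm_map (T x), ← b.repr.norm_map x]
  have : ‖b.repr (T x)‖ ≤ ‖(C : 𝕜) • b.repr x‖ := by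
    refine lp.norm_mono (by norm_num) fun i => ?_
    rw [lp.coeFn_smul, Pi.smul_apply, norm_smul, b.repr_apply_apply, b.repr_apply_apply,
      RCLike.norm_ofReal, abs_of_nonneg hC]
    exact h x i
  simpa [norm_smul, abs_of_nonneg hC] using this

/-- The bounded operator that multiplies the coordinates in a Hilbert basis by a bounded family. -/
theorem exists_diagonal (b : HilbertBasis ι 𝕜 E) (c : ι → 𝕜) {C : ℝ} (hC : ∀ i, ‖c i‖ ≤ C) :
    ∃ T : E →L[𝕜] E, ∀ x i, ⟪b i, T x⟫_𝕜 = c i * ⟪b i, x⟫_𝕜 := by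
  have hmem : ∀ f : lp (fun _ : ι => 𝕜) 2, Memℓp (fun i => c i * f i) 2 := fun f => by
    have hf : Memℓp (fun i => C * ‖f i‖) 2 := (lp.memℓp f).norm.const_smul C
    refine hf.mono fun i => ?_
    rw [norm_mul]
    exact mul_le_mul_of_nonneg_right (hC i) (norm_nonneg _)
  let T : E →ₗ[𝕜] E :=
    { toFun := fun x => b.repr.symm ⟨fun i => c i * b.repr x i, hmem _⟩
      map_add' := fun x y => by
        rw [← map_add]
        congr 1
        ext i
        simp only [map_add]
        exact mul_add _ _ _
      map_smul' := fun a x => by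
        rw [← map_smul]
        congr 1
        ext i
        simp [mul_left_comm] }
  have hT : ∀ x i, ⟪b i, T x⟫_𝕜 = c i * ⟪b i, x⟫_𝕜 := fun x i => by
    simp only [← HilbertBasis.repr_apply_apply]
    simp [T]
  refine ⟨T.mkContinuous |C| fun x => ?_, hT⟩
  rw [← b.repr.norm_map (T x), ← b.repr.norm_map x]
  have : ‖b.repr (T x)‖ ≤ ‖((|C| : ℝ) : 𝕜) • b.repr x‖ := by
    refine lp.norm_mono (by norm_num) fun i => ?_
    rw [lp.coeFn_smul, Pi.smul_apply, norm_smul, b.repr_apply_apply, b.repr_apply_apply,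
      hT, norm_mul, RCLike.norm_ofReal, abs_abs]
    exact mul_le_mul_of_nonneg_right ((hC i).trans (le_abs_self C)) (norm_nonneg _)
  simpa [norm_smul] using this

theorem isCompactOperator_rankOne (u v : E) :
    IsCompactOperator ((innerSL 𝕜 u).smulRight v) := by
  have h : IsCompactOperator (id : 𝕜 → 𝕜) := isCompactOperator_id
  exact (h.comp_clm (innerSL 𝕜 u)).clm_comp (ContinuousLinearMap.toSpanSingleton 𝕜 v)

/-- A diagonal operator whose entries tend to zero is compact. -/
theorem isCompactOperator_diagonal [CompleteSpace E] (b : HilbertBasis ι 𝕜 E) (c : ι → 𝕜)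
    (hc : Tendsto c cofinite (𝓝 0)) (T : E →L[𝕜] E)
    (hT : ∀ x i, ⟪b i, T x⟫_𝕜 = c i * ⟪b i, x⟫_𝕜) : IsCompactOperator T := by
  classical
  let F : Finset ι → E →L[𝕜] E := fun s => ∑ i ∈ s, c i • (innerSL 𝕜 (b i)).smulRight (b i)
  have hF : ∀ s x i, ⟪b i, F s x⟫_𝕜 = if i ∈ s then c i * ⟪b i, x⟫_𝕜 else 0 := fun s x i => by
    simp only [F, sum_apply, smul_apply,
      ContinuousLinearMap.smulRight_apply, innerSL_apply_apply, inner_sum, inner_smul_right,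
      orthonormal_iff_ite.1 b.orthonormal]
    simp
  refine isCompactOperator_of_tendsto (l := atTop) (F := F) ?_ (Eventually.of_forall fun s => ?_)
  · rw [Metric.tendsto_atTop]
    intro ε hε
    -- Only finitely many coefficients reach `ε / 2`; a truncation containing them all leaves an
    -- error of norm at most `ε / 2`.
    have hfin : {i | ¬ ‖c i‖ < ε / 2}.Finite := by
      have := (tendsto_zero_iff_norm_tendsto_zero.1 hc).eventually (gt_mem_nhds (half_pos hε))
      exact this
    refine ⟨hfin.toFinset, fun s hs => ?_⟩
    rw [dist_comm, dist_eq_norm]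
    refine lt_of_le_of_lt (opNorm_le_of_norm_inner_le b _ (half_pos hε).le fun x i => ?_)
      (half_lt_self hε)
    rw [sub_apply, inner_sub_right, hT, hF]
    split_ifs with hi
    · simpa using by positivity
    · rw [sub_zero, norm_mul]
      refine mul_le_mul_of_nonneg_right ?_ (norm_nonneg _)
      by_contra hlt
      exact hi (hs (hfin.mem_toFinset.2 fun h => hlt h.le))
  · exact (compactOperator (RingHom.id 𝕜) E E).sum_mem fun i _ =>
      (isCompactOperator_rankOne (b i) (b i)).smul (c i)

/-- `L` is the maximal operator that is diagonal in the Hilbert basis `b`, with diagonal `d`. -/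
def IsDiagonal (L : E →ₗ.[𝕜] E) (b : HilbertBasis ι 𝕜 E) (d : ι → ℝ) : Prop :=
  ∀ x y : E, (∃ h : x ∈ L.domain, L ⟨x, h⟩ = y) ↔ ∀ i, ⟪b i, y⟫_𝕜 = (d i : 𝕜) * ⟪b i, x⟫_𝕜

namespace IsDiagonal

variable {L : E →ₗ.[𝕜] E} {b : HilbertBasis ι 𝕜 E} {d : ι → ℝ}

theorem inner_apply (hL : IsDiagonal L b d) (x : L.domain) (i : ι) :
    ⟪b i, L x⟫_𝕜 = (d i : 𝕜) * ⟪b i, (x : E)⟫_𝕜 :=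
  (hL x (L x)).1 ⟨x.2, rfl⟩ i

theorem basis_apply (hL : IsDiagonal L b d) (i : ι) :
    ∃ h : b i ∈ L.domain, L ⟨b i, h⟩ = (d i : 𝕜) • b i := by
  classical
  refine (hL _ _).2 fun j => ?_
  rw [inner_smul_right, orthonormal_iff_ite.1 b.orthonormal]
  split_ifs with h <;> simp [h]

theorem dense_domain (hL : IsDiagonal L b d) : Dense (L.domain : Set E) := by
  have h : Submodule.span 𝕜 (Set.range b) ≤ L.domain :=
    Submodule.span_le.2 (by rintro _ ⟨i, rfl⟩; exact (hL.basis_apply i).1)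
  have hd : Dense (Submodule.span 𝕜 (Set.range b) : Set E) :=
    (Submodule.dense_iff_topologicalClosure_eq_top).2 b.dense_span
  exact hd.mono h

/-- A real diagonal makes `L` symmetric. Conversely, testing a vector of the adjoint domain against
the basis shows that the adjoint acts on it diagonally, and maximality puts the vector in the domain
of `L`. -/
theorem isSelfAdjoint [CompleteSpace E] (hL : IsDiagonal L b d) : IsSelfAdjoint L := by
  have hsymm : ∀ x y : L.domain, ⟪L x, (y : E)⟫_𝕜 = ⟪(x : E), L y⟫_𝕜 := fun x y => by
    rw [← b.tsum_inner_mul_inner, ← b.tsum_inner_mul_inner]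
    congr 1
    funext i
    rw [hL.inner_apply y, ← inner_conj_symm (L x) (b i), hL.inner_apply x,
      ← inner_conj_symm (x : E) (b i)]
    simp only [map_mul, RCLike.conj_ofReal]
    ring
  rw [LinearPMap.isSelfAdjoint_def]
  have key : ∀ y : L.adjoint.domain, ∃ h : (y : E) ∈ L.domain, L ⟨y, h⟩ = L.adjoint y := by
    intro y
    refine (hL _ _).2 fun i => ?_
    obtain ⟨hi, hLi⟩ := hL.basis_apply i
    have h := LinearPMap.adjoint_isFormalAdjoint hL.dense_domain y ⟨b i, hi⟩
    rw [hLi, inner_smul_right] at h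
    rw [← inner_conj_symm, h, map_mul, RCLike.conj_ofReal, inner_conj_symm]
  refine le_antisymm (LinearPMap.le_of_le_graph fun w hw => ?_)
    (LinearPMap.IsFormalAdjoint.le_adjoint hL.dense_domain hsymm)
  obtain ⟨y, hy, hy'⟩ := (LinearPMap.mem_graph_iff _).1 hw
  obtain ⟨h, h'⟩ := key y
  exact (LinearPMap.mem_graph_iff _).2 ⟨⟨y, h⟩, hy, h'.trans hy'⟩

/-- Any resolvent is forced to be diagonal with entries `1 / (d i - z)`; this excludes resolvents at
the `d i` and gives compactness elsewhere. -/
theorem inner_resolvent (hL : IsDiagonal L b d) {z : 𝕜} {R : E →L[𝕜] E} (hR : IsResolvent L z R)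
    (y : E) (i : ι) : ((d i : 𝕜) - z) * ⟪b i, R y⟫_𝕜 = ⟪b i, y⟫_𝕜 := by
  obtain ⟨h, hy⟩ := hR.1 y
  conv_rhs => rw [← hy]
  rw [inner_sub_right, hL.inner_apply, inner_smul_right]
  ring

theorem sub_ne_zero_of_isResolvent (hL : IsDiagonal L b d) {z : 𝕜} {R : E →L[𝕜] E}
    (hR : IsResolvent L z R) (i : ι) : (d i : 𝕜) - z ≠ 0 := fun h0 => by
  have := hL.inner_resolvent hR (b i) i
  rw [h0, zero_mul, inner_self_eq_norm_sq_to_K, b.orthonormal.1 i] at this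
  simp at this

theorem tendsto_inv_sub (hd : Tendsto (fun i => |d i|) cofinite atTop) (z : 𝕜) :
    Tendsto (fun i => ((d i : 𝕜) - z)⁻¹) cofinite (𝓝 0) := by
  refine tendsto_inv₀_cobounded.comp ?_
  rw [tendsto_norm_atTop_iff_cobounded.symm]
  refine tendsto_atTop_mono (fun i => ?_) (tendsto_atTop_add_const_right _ (-‖z‖) hd)
  have := norm_sub_norm_le (d i : 𝕜) z
  rwa [RCLike.norm_ofReal] at this

theorem exists_isResolvent (hL : IsDiagonal L b d) (hd : Tendsto (fun i => |d i|) cofinite atTop)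
    {z : 𝕜} (hz : ∀ i, (d i : 𝕜) ≠ z) : ∃ R, IsResolvent L z R := by
  have hbdd : ∃ C : ℝ, ∀ i, ‖((d i : 𝕜) - z)⁻¹‖ ≤ C := by
    have hfin : {i | ¬ ‖((d i : 𝕜) - z)⁻¹‖ < 1}.Finite := by
      have := (tendsto_zero_iff_norm_tendsto_zero.1 (tendsto_inv_sub hd z)).eventually
        (gt_mem_nhds one_pos)
      exact this
    obtain ⟨C, hC⟩ := (hfin.image fun i => ‖((d i : 𝕜) - z)⁻¹‖).bddAbove
    refine ⟨max C 1, fun i => ?_⟩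
    by_cases hi : ‖((d i : 𝕜) - z)⁻¹‖ < 1
    · exact hi.le.trans (le_max_right _ _)
    · exact (hC (Set.mem_image_of_mem _ hi)).trans (le_max_left _ _)
  obtain ⟨C, hC⟩ := hbdd
  obtain ⟨R, hR⟩ := exists_diagonal b _ hC
  have hz' : ∀ i, (d i : 𝕜) - z ≠ 0 := fun i => sub_ne_zero.2 (hz i)
  refine ⟨R, fun y => ?_, fun x => hilbertBasis_ext b fun i => ?_⟩
  · obtain ⟨h, hLy⟩ := (hL (R y) (y + z • R y)).2 fun i => by
      rw [inner_add_right, inner_smul_right, hR]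
      field_simp [hz' i]
      ring
    exact ⟨h, by rw [hLy, add_sub_cancel_right]⟩
  · rw [hR, inner_sub_right, inner_smul_right, hL.inner_apply, ← sub_mul, ← mul_assoc,
      inv_mul_cancel₀ (hz' i), one_mul]

theorem unboundedSpectrum_eq (hL : IsDiagonal L b d)
    (hd : Tendsto (fun i => |d i|) cofinite atTop) :
    unboundedSpectrum L = Set.range fun i => (d i : 𝕜) := by
  ext z
  refine ⟨fun hz => ?_, ?_⟩
  · by_contra h
    exact hz (hL.exists_isResolvent hd fun i hi => h ⟨i, hi⟩)
  · rintro ⟨i, rfl⟩ ⟨R, hR⟩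
    exact hL.sub_ne_zero_of_isResolvent hR i (sub_self _)

theorem hasCompactResolvent [CompleteSpace E] (hL : IsDiagonal L b d)
    (hd : Tendsto (fun i => |d i|) cofinite atTop) {z : 𝕜} (hz : ∀ i, (d i : 𝕜) ≠ z) :
    HasCompactResolvent L := by
  refine ⟨⟨z, hL.exists_isResolvent hd hz⟩, fun w R hR => ?_⟩
  refine isCompactOperator_diagonal b _ (tendsto_inv_sub hd w) R fun x i => ?_
  rw [← hL.inner_resolvent hR x i, ← mul_assoc,
    inv_mul_cancel₀ (hL.sub_ne_zero_of_isResolvent hR i), one_mul]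

theorem exists_inter_ball_eq_singleton (hL : IsDiagonal L b d)
    (hd : Tendsto (fun i => |d i|) cofinite atTop) {z : 𝕜} (hz : z ∈ unboundedSpectrum L) :
    ∃ ε > 0, unboundedSpectrum L ∩ Metric.ball z ε = {z} := by
  have hfin : (unboundedSpectrum L ∩ Metric.ball z 1).Finite := by
    -- A diagonal entry within distance `1` of `z` has modulus below `‖z‖ + 1`.
    have h : {i | ¬ |d i| ≥ ‖z‖ + 1}.Finite := hd.eventually (eventually_ge_atTop _)
    refine (h.image fun i => (d i : 𝕜)).subset ?_
    rw [hL.unboundedSpectrum_eq hd]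
    rintro _ ⟨⟨i, rfl⟩, hi⟩
    refine ⟨i, fun hge => ?_, rfl⟩
    rw [Metric.mem_ball, dist_eq_norm] at hi
    have := norm_sub_norm_le (d i : 𝕜) z
    rw [RCLike.norm_ofReal] at this
    linarith
  have hopen : IsOpen ((unboundedSpectrum L ∩ Metric.ball z 1) \ {z})ᶜ :=
    (hfin.subset Set.sdiff_subset).isClosed.isOpen_compl
  obtain ⟨ε, hε, hsub⟩ := Metric.isOpen_iff.1 hopen z (by simp)
  refine ⟨min ε 1, lt_min hε one_pos, Set.Subset.antisymm ?_ ?_⟩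
  · rintro w ⟨hw, hwz⟩
    by_contra hne
    refine hsub (Metric.ball_subset_ball (min_le_left _ _) hwz) ⟨⟨hw, ?_⟩, hne⟩
    exact Metric.ball_subset_ball (min_le_right _ _) hwz
  · rintro _ rfl
    exact ⟨hz, Metric.mem_ball_self (lt_min hε one_pos)⟩

/-- The multiplicity of an eigenvalue is the number of its occurrences on the diagonal. -/
theorem finrank_unboundedEigenspace (hL : IsDiagonal L b d) (z : 𝕜) (s : Finset ι)
    (hs : ∀ i, i ∈ s ↔ (d i : 𝕜) = z) :
    Module.finrank 𝕜 (unboundedEigenspace L z) = s.card := by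
  classical
  have hmem : ∀ x : L.domain, x ∈ unboundedEigenspace L z ↔ L x = z • (x : E) := fun x => by
    rw [unboundedEigenspace, LinearMap.mem_ker, LinearMap.sub_apply, sub_eq_zero]
    rfl
  -- The coordinates in `s` identify the eigenspace with `s → 𝕜`, since all other coordinates of an
  -- eigenvector vanish.
  let F : unboundedEigenspace L z →ₗ[𝕜] (s → 𝕜) :=
    { toFun := fun x i => ⟪b i, ((x : L.domain) : E)⟫_𝕜
      map_add' := fun x y => by funext i; simp [inner_add_right]
      map_smul' := fun c x => by funext i; simp [inner_smul_right] }
  have hinj : Function.Injective F := by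
    intro x y hxy
    refine Subtype.ext (Subtype.ext (hilbertBasis_ext b fun i => ?_))
    by_cases hi : i ∈ s
    · exact congrFun hxy ⟨i, hi⟩
    · have hz : (d i : 𝕜) - z ≠ 0 := sub_ne_zero.2 fun h => hi ((hs i).2 h)
      have h0 : ∀ x : unboundedEigenspace L z, ⟪b i, ((x : L.domain) : E)⟫_𝕜 = 0 := fun x => by
        have h := hL.inner_apply x i
        rw [(hmem _).1 x.2, inner_smul_right] at h
        have h' : ((d i : 𝕜) - z) * ⟪b i, ((x : L.domain) : E)⟫_𝕜 = 0 := by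
          rw [sub_mul, h, sub_self]
        exact (mul_eq_zero.1 h').resolve_left hz
      rw [h0, h0]
  have hsurj : Function.Surjective F := by
    intro f
    have hx : ∀ i, ⟪b i, ∑ j : s, f j • b j⟫_𝕜 = if h : i ∈ s then f ⟨i, h⟩ else 0 := fun i => by
      simp only [inner_sum, inner_smul_right, orthonormal_iff_ite.1 b.orthonormal]
      split_ifs with h
      · rw [Finset.sum_eq_single ⟨i, h⟩]
        · simp
        · rintro j - hj
          rw [if_neg fun hij => hj (Subtype.ext hij.symm), mul_zero]
        · simp
      · refine Finset.sum_eq_zero fun j _ => ?_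
        rw [if_neg fun hij : i = j => h (hij ▸ j.2), mul_zero]
    obtain ⟨h, hLx⟩ := (hL (∑ j : s, f j • b j) (z • ∑ j : s, f j • b j)).2 fun i => by
      rw [inner_smul_right, hx]
      split_ifs with hi
      · rw [(hs i).1 hi]
      · simp
    refine ⟨⟨⟨_, h⟩, (hmem _).2 hLx⟩, funext fun i => ?_⟩
    change ⟪b i, ∑ j : s, f j • b j⟫_𝕜 = f i
    rw [hx, dif_pos i.2]
  rw [(LinearEquiv.ofBijective F ⟨hinj, hsurj⟩).finrank_eq, Module.finrank_fintype_fun_eq_card,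
    Fintype.card_coe]

end IsDiagonal

end Diagonal

/-! ### Closed form of the matrix entries. -/

section Entries

/-- Raise both `n` and `j` by one: the two end terms equal `1`, and each of the `n + j + 1` inner
terms exceeds its predecessor by `1`, for a total of `(n + 1)(j + 1) + (n + j + 1) + 2 = (n + 2)(j +
2)`. -/
theorem sum_range_min_succ (n j : ℕ) :
    ∑ k ∈ Finset.range (n + j + 1), (min (min n j) (min k (n + j - k)) + 1) =
      (n + 1) * (j + 1) := by
  induction n generalizing j with
  | zero => simp
  | succ n ih =>
    cases j with
    | zero => simp
    | succ j =>
      have h : ∀ k ∈ Finset.range (n + j + 1),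
          min (min (n + 1) (j + 1)) (min (k + 1) (n + 1 + (j + 1) - (k + 1))) + 1 =
            min (min n j) (min k (n + j - k)) + 1 + 1 := fun k hk => by
        rw [Finset.mem_range] at hk
        omega
      rw [show n + 1 + (j + 1) + 1 = (n + j + 1 + 1) + 1 by ring, Finset.sum_range_succ,
        Finset.sum_range_succ', Finset.sum_congr rfl h, Finset.sum_add_distrib, ih,
        show min (min (n + 1) (j + 1)) (min (n + j + 1 + 1) (n + 1 + (j + 1) - (n + j + 1 + 1))) = 0
          by omega]
      simp
      ring

theorem hasSum_of_shift {f : ℕ → ℝ} {a : ℝ} (d : ℕ) (h0 : ∀ i < d, f i = 0)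
    (h : HasSum (fun k => f (k + d)) a) : HasSum f a := by
  have := (hasSum_nat_add_iff d).1 h
  rwa [Finset.sum_eq_zero fun i hi => h0 i (Finset.mem_range.1 hi), add_zero] at this

/-- Passing from `n` to `n + 1` adds `1` to the coefficients with `k ≥ n + 1`, that is, a geometric
tail. -/
theorem hasSum_min_succ_mul_pow {x : ℝ} (hx0 : 0 ≤ x) (hx1 : x < 1) (n : ℕ) :
    HasSum (fun k : ℕ => ((min n k + 1 : ℕ) : ℝ) * x ^ k) ((1 - x ^ (n + 1)) / (1 - x) ^ 2) := by
  have hx : 1 - x ≠ 0 := by linarith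
  induction n with
  | zero =>
    convert hasSum_geometric_of_lt_one hx0 hx1 using 1
    · simp
    · field_simp
      ring
  | succ n ih =>
    have h : HasSum (fun k : ℕ => if n + 1 ≤ k then x ^ k else 0) (x ^ (n + 1) * (1 - x)⁻¹) := by
      refine hasSum_of_shift (n + 1) (fun i hi => if_neg (by omega)) ?_
      convert (hasSum_geometric_of_lt_one hx0 hx1).mul_left (x ^ (n + 1)) using 1
      · rfl
      funext k
      rw [if_pos (by omega), pow_add, mul_comm]
    convert ih.add h using 1
    · funext k
      split_ifs with hk
      · rw [min_eq_left hk, min_eq_left (by omega)]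
        push_cast
        ring
      · rw [min_eq_right (by omega), min_eq_right (by omega), add_zero]
    · field_simp
      ring

variable {p : ℝ}

theorem tsum_interaction_groundState (hp0 : 0 ≤ p) (hp1 : p < 1) (n j : ℕ) :
    (∑' k : ℕ, if j ≤ n + k then interaction n j k (n + k - j) *
      (groundState p k * groundState p (n + k - j)) else 0) =
      p ^ ((n : ℤ) - (j : ℤ)).natAbs - p ^ (2 + n + j) := by
  have hx0 : 0 ≤ p ^ 2 := by positivity
  have hx1 : p ^ 2 < 1 := by nlinarith
  have hx : (1 - p ^ 2) ≠ 0 := by linarith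
  rcases le_total j n with h | h
  · obtain ⟨d, rfl⟩ := Nat.exists_eq_add_of_le h
    have hs := (hasSum_min_succ_mul_pow hx0 hx1 j).mul_left ((1 - p ^ 2) ^ 2 * p ^ d)
    rw [show ((j + d : ℕ) : ℤ) - (j : ℤ) = (d : ℤ) by push_cast; ring, Int.natAbs_natCast]
    convert hs.tsum_eq using 1
    · congr 1
      funext k
      rw [if_pos (by omega), show j + d + k - j = d + k by omega, interaction,
        show min (min (j + d) j) (min k (d + k)) = min j k by omega, groundState, groundState]
      ring
    · field_simp
      ring
  · obtain ⟨d, rfl⟩ := Nat.exists_eq_add_of_le h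
    have hs := (hasSum_min_succ_mul_pow hx0 hx1 n).mul_left ((1 - p ^ 2) ^ 2 * p ^ d)
    rw [show (n : ℤ) - ((n + d : ℕ) : ℤ) = -(d : ℤ) by push_cast; ring, Int.natAbs_neg,
      Int.natAbs_natCast]
    refine HasSum.tsum_eq ?_
    -- The indices below `d = j - n` are those cut off by the constraint `j ≤ n + k`.
    refine hasSum_of_shift d (fun i hi => if_neg (by omega)) ?_
    convert hs using 1
    · rfl
    · funext k
      rw [if_pos (by omega), show n + (k + d) - (n + d) = k by omega, interaction,
        show min (min n (n + d)) (min (k + d) k) = min n k by omega, groundState, groundState]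
      ring
    · field_simp
      ring

/-- The product of the two amplitudes does not depend on `k`, so only the sum of the minima remains.
-/
theorem sum_interaction_groundState (n j : ℕ) :
    ∑ k ∈ Finset.range (n + j + 1), interaction n j k (n + j - k) *
      (groundState p k * groundState p (n + j - k)) =
      (1 - p ^ 2) ^ 2 * ((j : ℝ) + 1) * ((n : ℝ) + 1) * p ^ (n + j) := by
  have h : ∀ k ∈ Finset.range (n + j + 1), interaction n j k (n + j - k) *
      (groundState p k * groundState p (n + j - k)) =
      ((min (min n j) (min k (n + j - k)) + 1 : ℕ) : ℝ) * ((1 - p ^ 2) ^ 2 * p ^ (n + j)) := by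
    intro k hk
    rw [Finset.mem_range] at hk
    rw [interaction, groundState, groundState]
    conv_rhs => rw [show n + j = k + (n + j - k) by omega, pow_add,
      show k + (n + j - k) = n + j by omega]
    ring
  rw [Finset.sum_congr rfl h, ← Finset.sum_mul, ← Nat.cast_sum, sum_range_min_succ]
  push_cast
  ring

theorem hessianEntry_groundState (hp0 : 0 ≤ p) (hp1 : p < 1) (s : ℤˣ) (n j : ℕ) :
    hessianEntry s (groundState p) n j =
      2 * p ^ ((n : ℤ) - (j : ℤ)).natAbs - 2 * p ^ (2 + n + j) +
        ((s : ℤ) : ℝ) * ((1 - p ^ 2) ^ 2 * ((j : ℝ) + 1) * ((n : ℝ) + 1) * p ^ (n + j)) := by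
  rw [hessianEntry, tsum_interaction_groundState hp0 hp1, sum_interaction_groundState]
  ring

end Entries

/-! ### The right shift and its adjoint. -/

section Shift

variable (𝕜 : Type*) [RCLike 𝕜]

/-- The function `0, x₀, x₁, …`. -/
def shiftFun {𝕜 : Type*} [RCLike 𝕜] (x : ℕ → 𝕜) : ℕ → 𝕜
  | 0 => 0
  | n + 1 => x n

theorem memℓp_shiftFun (x : Ell2 𝕜) : Memℓp (shiftFun (x : ℕ → 𝕜)) 2 := by
  have h := (lp.memℓp x).summable (by norm_num)
  refine memℓp_gen ?_
  rw [← summable_nat_add_iff 1]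
  exact h

/-- The right shift on `ℓ²`. -/
def shiftIsometry : Ell2 𝕜 →ₗᵢ[𝕜] Ell2 𝕜 :=
  LinearMap.isometryOfInner
    { toFun := fun x => ⟨shiftFun (x : ℕ → 𝕜), memℓp_shiftFun 𝕜 x⟩
      map_add' := fun x y => by
        ext n
        cases n
        · exact (add_zero (0 : 𝕜)).symm
        · rfl
      map_smul' := fun c x => by
        ext n
        cases n
        · exact (mul_zero c).symm
        · rfl }
    (fun x y => by
      have hs := lp.summable_inner (𝕜 := 𝕜) (⟨shiftFun (x : ℕ → 𝕜), memℓp_shiftFun 𝕜 x⟩ : Ell2 𝕜)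
        ⟨shiftFun (y : ℕ → 𝕜), memℓp_shiftFun 𝕜 y⟩
      rw [lp.inner_eq_tsum, lp.inner_eq_tsum]
      refine hs.tsum_eq_zero_add.trans ?_
      simp [shiftFun])

/-- The right shift on `ℓ²` as a bounded operator. -/
def shift : Ell2 𝕜 →L[𝕜] Ell2 𝕜 := (shiftIsometry 𝕜).toContinuousLinearMap

/-- The left shift on `ℓ²`. -/
def backwardShift : Ell2 𝕜 →L[𝕜] Ell2 𝕜 := ContinuousLinearMap.adjoint (shift 𝕜)

/-- The standard basis vectors of `ℓ²`. -/
def stdVec (n : ℕ) : Ell2 𝕜 := lp.single 2 n (1 : 𝕜)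

variable {𝕜}

theorem inner_stdVec (n : ℕ) (x : Ell2 𝕜) : ⟪stdVec 𝕜 n, x⟫_𝕜 = x n := by
  simp [stdVec, lp.inner_single_left]

theorem stdVec_apply (n j : ℕ) : stdVec 𝕜 n j = if n = j then 1 else 0 := by
  simp only [stdVec, lp.single_apply, Pi.single_apply, eq_comm]

theorem ell2_ext {x y : Ell2 𝕜} (h : ∀ n, x n = y n) : x = y := lp.ext (funext h)

theorem add_coord (x y : Ell2 𝕜) (n : ℕ) : (x + y) n = x n + y n := rfl

theorem sub_coord (x y : Ell2 𝕜) (n : ℕ) : (x - y) n = x n - y n := rfl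

theorem smul_coord (c : 𝕜) (x : Ell2 𝕜) (n : ℕ) : (c • x) n = c * x n := rfl

theorem zero_coord (n : ℕ) : (0 : Ell2 𝕜) n = 0 := rfl

theorem shift_zero (x : Ell2 𝕜) : shift 𝕜 x 0 = 0 := rfl

theorem shift_succ (x : Ell2 𝕜) (n : ℕ) : shift 𝕜 x (n + 1) = x n := rfl

theorem inner_shift_shift (x y : Ell2 𝕜) : ⟪shift 𝕜 x, shift 𝕜 y⟫_𝕜 = ⟪x, y⟫_𝕜 :=
  (shiftIsometry 𝕜).inner_map_map x y

theorem shift_stdVec (n : ℕ) : shift 𝕜 (stdVec 𝕜 n) = stdVec 𝕜 (n + 1) := by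
  refine ell2_ext fun j => ?_
  cases j
  · rw [shift_zero, stdVec_apply, if_neg (by omega)]
  · rw [shift_succ, stdVec_apply, stdVec_apply]
    simp

theorem inner_shift_left (x y : Ell2 𝕜) :
    ⟪shift 𝕜 x, y⟫_𝕜 = ⟪x, backwardShift 𝕜 y⟫_𝕜 :=
  (ContinuousLinearMap.adjoint_inner_right _ _ _).symm

theorem inner_shift_right (x y : Ell2 𝕜) :
    ⟪x, shift 𝕜 y⟫_𝕜 = ⟪backwardShift 𝕜 x, y⟫_𝕜 :=
  (ContinuousLinearMap.adjoint_inner_left _ _ _).symm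

theorem backwardShift_apply (x : Ell2 𝕜) (n : ℕ) : backwardShift 𝕜 x n = x (n + 1) := by
  rw [← inner_stdVec, ← inner_shift_left, shift_stdVec, inner_stdVec]

theorem backwardShift_shift (x : Ell2 𝕜) : backwardShift 𝕜 (shift 𝕜 x) = x :=
  ell2_ext fun n => by rw [backwardShift_apply, shift_succ]

theorem backwardShift_stdVec_zero : backwardShift 𝕜 (stdVec 𝕜 0) = 0 :=
  ell2_ext fun n => by rw [backwardShift_apply, stdVec_apply, if_neg (by omega), zero_coord]

theorem backwardShift_stdVec_succ (n : ℕ) : backwardShift 𝕜 (stdVec 𝕜 (n + 1)) = stdVec 𝕜 n := by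
  rw [← shift_stdVec, backwardShift_shift]

theorem norm_smul_shift_lt_one {p : ℝ} (hp : |p| < 1) : ‖(p : 𝕜) • shift 𝕜‖ < 1 := by
  refine lt_of_le_of_lt ?_ hp
  rw [norm_smul, RCLike.norm_ofReal]
  exact mul_le_of_le_one_right (abs_nonneg _) (shiftIsometry 𝕜).norm_toContinuousLinearMap_le

end Shift

/-! ### The inner operator and the complement of the range of its square. -/

section Geom

variable (𝕜 : Type*) [RCLike 𝕜] (p : ℝ)

/-- The operator `(1 - p S)⁻¹`, with `S` the right shift. -/
def geom : Ell2 𝕜 →L[𝕜] Ell2 𝕜 := Ring.inverse (1 - (p : 𝕜) • shift 𝕜)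

/-- The adjoint of `(1 - p S)⁻¹`. -/
def geomAdj : Ell2 𝕜 →L[𝕜] Ell2 𝕜 := ContinuousLinearMap.adjoint (geom 𝕜 p)

/-- The operator with matrix `p ^ |n - j| - p ^ (2 + n + j)`. -/
def greenOp : Ell2 𝕜 →L[𝕜] Ell2 𝕜 := (1 - (p : 𝕜) ^ 2) • (geom 𝕜 p * geomAdj 𝕜 p)

/-- The inner operator `(S - p) (1 - p S)⁻¹`. -/
def blaschke : Ell2 𝕜 →L[𝕜] Ell2 𝕜 := shift 𝕜 * geom 𝕜 p - (p : 𝕜) • geom 𝕜 p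

/-- The vector `pⁿ`. -/
def geomVec : Ell2 𝕜 := geom 𝕜 p (stdVec 𝕜 0)

/-- The vector `(n + 1) pⁿ`. -/
def derivVec : Ell2 𝕜 := geom 𝕜 p (geomVec 𝕜 p)

/-- The vector orthogonal to `(n + 1) pⁿ` in the kernel of the squared adjoint of the inner
operator. -/
def kernelVec : Ell2 𝕜 := blaschke 𝕜 p (geomVec 𝕜 p) - (p : 𝕜) • geomVec 𝕜 p

variable {𝕜 p}

theorem one_sub_sq_ne_zero (hp : |p| < 1) : (1 - (p : 𝕜) ^ 2) ≠ 0 := by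
  have h : (1 - p ^ 2 : ℝ) ≠ 0 := by
    have := (sq_lt_one_iff_abs_lt_one p).2 hp
    linarith
  exact_mod_cast (RCLike.ofReal_ne_zero (K := 𝕜)).2 h

theorem one_add_sq_ne_zero : (1 + (p : 𝕜) ^ 2) ≠ 0 := by
  have h : (1 + p ^ 2 : ℝ) ≠ 0 := by positivity
  exact_mod_cast (RCLike.ofReal_ne_zero (K := 𝕜)).2 h

theorem isUnit_one_sub_shift (hp : |p| < 1) : IsUnit (1 - (p : 𝕜) • shift 𝕜) :=
  isUnit_one_sub_of_norm_lt_one (norm_smul_shift_lt_one hp)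

/-- This fixed-point equation stands in for the Neumann series: coordinates and inner products are
obtained by solving it recursively. -/
theorem geom_eq (hp : |p| < 1) (x : Ell2 𝕜) :
    geom 𝕜 p x = x + (p : 𝕜) • shift 𝕜 (geom 𝕜 p x) := by
  have h := DFunLike.congr_fun (Ring.mul_inverse_cancel _ (isUnit_one_sub_shift (𝕜 := 𝕜) hp)) x
  exact sub_eq_iff_eq_add.1 h

theorem geom_eq' (hp : |p| < 1) (x : Ell2 𝕜) :
    geom 𝕜 p x = x + (p : 𝕜) • geom 𝕜 p (shift 𝕜 x) := by
  have h := DFunLike.congr_fun (Ring.inverse_mul_cancel _ (isUnit_one_sub_shift (𝕜 := 𝕜) hp)) x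
  have h' : geom 𝕜 p (x - (p : 𝕜) • shift 𝕜 x) = x := h
  rw [map_sub, map_smul] at h'
  exact sub_eq_iff_eq_add.1 h'

theorem geom_shift (hp : |p| < 1) (x : Ell2 𝕜) :
    geom 𝕜 p (shift 𝕜 x) = shift 𝕜 (geom 𝕜 p x) := by
  have hu := isUnit_one_sub_shift (𝕜 := 𝕜) hp
  have h : Commute (shift 𝕜) (1 - (p : 𝕜) • shift 𝕜) :=
    (Commute.one_right _).sub_right ((Commute.refl _).smul_right _)
  have h' : Commute (shift 𝕜) (geom 𝕜 p) := by
    obtain ⟨w, hw⟩ := hu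
    rw [geom, ← hw, Ring.inverse_unit]
    exact (hw ▸ h : Commute (shift 𝕜) (w : Ell2 𝕜 →L[𝕜] Ell2 𝕜)).units_inv_right
  exact (DFunLike.congr_fun h'.eq x).symm

theorem inner_geomAdj_left (x y : Ell2 𝕜) : ⟪geomAdj 𝕜 p x, y⟫_𝕜 = ⟪x, geom 𝕜 p y⟫_𝕜 :=
  ContinuousLinearMap.adjoint_inner_left _ _ _

theorem inner_geom_left (x y : Ell2 𝕜) : ⟪geom 𝕜 p x, y⟫_𝕜 = ⟪x, geomAdj 𝕜 p y⟫_𝕜 :=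
  (ContinuousLinearMap.adjoint_inner_right _ _ _).symm

theorem geomAdj_eq (hp : |p| < 1) (x : Ell2 𝕜) :
    geomAdj 𝕜 p x = x + (p : 𝕜) • geomAdj 𝕜 p (backwardShift 𝕜 x) := by
  refine ext_inner_right 𝕜 fun y => ?_
  rw [inner_geomAdj_left, inner_add_left, inner_smul_left, inner_geomAdj_left,
    ← inner_shift_right, RCLike.conj_ofReal]
  conv_lhs => rw [geom_eq hp y, inner_add_right, inner_smul_right]

theorem geomAdj_shift (hp : |p| < 1) (x : Ell2 𝕜) :
    geomAdj 𝕜 p (shift 𝕜 x) = shift 𝕜 x + (p : 𝕜) • geomAdj 𝕜 p x := by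
  rw [geomAdj_eq hp (shift 𝕜 x), backwardShift_shift]

theorem blaschke_apply (x : Ell2 𝕜) :
    blaschke 𝕜 p x = shift 𝕜 (geom 𝕜 p x) - (p : 𝕜) • geom 𝕜 p x := rfl

theorem greenOp_apply (x : Ell2 𝕜) :
    greenOp 𝕜 p x = (1 - (p : 𝕜) ^ 2) • geom 𝕜 p (geomAdj 𝕜 p x) := rfl

theorem inner_greenOp_left (x y : Ell2 𝕜) :
    ⟪greenOp 𝕜 p x, y⟫_𝕜 = ⟪x, greenOp 𝕜 p y⟫_𝕜 := by
  rw [greenOp_apply, greenOp_apply, inner_smul_left, inner_smul_right, inner_geom_left,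
    inner_geomAdj_left (p := p) x]
  simp

/-- With `w = (1 - pS)⁻¹ z` one has `z = w - pSw` and `Vz = Sw - pw`; as `S` is isometric and `p`
real, the two expressions have equal inner products. -/
theorem inner_blaschke_blaschke (hp : |p| < 1) (x y : Ell2 𝕜) :
    ⟪blaschke 𝕜 p x, blaschke 𝕜 p y⟫_𝕜 = ⟪x, y⟫_𝕜 := by
  have h : ∀ z : Ell2 𝕜, z = geom 𝕜 p z - (p : 𝕜) • shift 𝕜 (geom 𝕜 p z) := fun z =>
    eq_sub_of_add_eq (geom_eq hp z).symm
  conv_rhs => rw [h x, h y]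
  simp only [blaschke_apply, inner_sub_left, inner_sub_right, inner_smul_left, inner_smul_right,
    inner_shift_shift, RCLike.conj_ofReal]
  ring

theorem geom_blaschke (hp : |p| < 1) (x : Ell2 𝕜) :
    geom 𝕜 p (blaschke 𝕜 p x) = blaschke 𝕜 p (geom 𝕜 p x) := by
  rw [blaschke_apply, blaschke_apply, map_sub, map_smul, geom_shift hp]

theorem shift_blaschke (hp : |p| < 1) (x : Ell2 𝕜) :
    shift 𝕜 (blaschke 𝕜 p x) = blaschke 𝕜 p (shift 𝕜 x) := by
  rw [blaschke_apply, blaschke_apply, map_sub, map_smul, geom_shift hp]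

/-- The relation `geomAdj S = S + p geomAdj` cancels the adjoint factor, leaving a function of `S`
alone: multiplication by `z b'(z)`. -/
theorem greenOp_blaschke (hp : |p| < 1) (x : Ell2 𝕜) :
    greenOp 𝕜 p (blaschke 𝕜 p x) =
      (1 - (p : 𝕜) ^ 2) • shift 𝕜 (geom 𝕜 p (geom 𝕜 p x)) := by
  rw [greenOp_apply, blaschke_apply, map_sub, map_smul, geomAdj_shift hp, add_sub_cancel_right,
    geom_shift hp]

theorem blaschke_greenOp_blaschke (hp : |p| < 1) (x : Ell2 𝕜) :
    blaschke 𝕜 p (greenOp 𝕜 p (blaschke 𝕜 p x)) =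
      greenOp 𝕜 p (blaschke 𝕜 p (blaschke 𝕜 p x)) := by
  rw [greenOp_blaschke hp, greenOp_blaschke hp, map_smul, ← shift_blaschke hp,
    ← geom_blaschke hp, ← geom_blaschke hp]

theorem geomVec_eq (hp : |p| < 1) :
    geomVec 𝕜 p = stdVec 𝕜 0 + (p : 𝕜) • shift 𝕜 (geomVec 𝕜 p) := geom_eq hp _

theorem derivVec_eq (hp : |p| < 1) :
    derivVec 𝕜 p = geomVec 𝕜 p + (p : 𝕜) • shift 𝕜 (derivVec 𝕜 p) := geom_eq hp _

theorem backwardShift_geomVec (hp : |p| < 1) :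
    backwardShift 𝕜 (geomVec 𝕜 p) = (p : 𝕜) • geomVec 𝕜 p := by
  conv_lhs => rw [geomVec_eq hp, map_add, map_smul, backwardShift_shift,
    backwardShift_stdVec_zero, zero_add]

theorem backwardShift_derivVec (hp : |p| < 1) :
    backwardShift 𝕜 (derivVec 𝕜 p) = (p : 𝕜) • geomVec 𝕜 p + (p : 𝕜) • derivVec 𝕜 p := by
  conv_lhs => rw [derivVec_eq hp, map_add, map_smul, backwardShift_shift,
    backwardShift_geomVec hp]

theorem geomVec_apply (hp : |p| < 1) (n : ℕ) : geomVec 𝕜 p n = (p : 𝕜) ^ n := by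
  induction n with
  | zero =>
    rw [geomVec_eq hp, add_coord, smul_coord, shift_zero, stdVec_apply]
    simp
  | succ n ih => rw [← backwardShift_apply, backwardShift_geomVec hp, smul_coord, ih, pow_succ']

theorem derivVec_apply (hp : |p| < 1) (n : ℕ) :
    derivVec 𝕜 p n = ((n : 𝕜) + 1) * (p : 𝕜) ^ n := by
  induction n with
  | zero =>
    rw [derivVec_eq hp, add_coord, smul_coord, shift_zero, geomVec_apply hp]
    simp
  | succ n ih =>
    rw [← backwardShift_apply, backwardShift_derivVec hp, add_coord, smul_coord, smul_coord, ih,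
      geomVec_apply hp]
    push_cast
    ring

theorem kernelVec_eq : kernelVec 𝕜 p =
    shift 𝕜 (derivVec 𝕜 p) - (p : 𝕜) • derivVec 𝕜 p - (p : 𝕜) • geomVec 𝕜 p := rfl

/-- Pairing with `geomVec` evaluates a power series at `p`, where `b` vanishes. -/
theorem inner_geomVec_blaschke (hp : |p| < 1) (x : Ell2 𝕜) :
    ⟪geomVec 𝕜 p, blaschke 𝕜 p x⟫_𝕜 = 0 := by
  rw [blaschke_apply, inner_sub_right, inner_shift_right, backwardShift_geomVec hp,
    inner_smul_left, inner_smul_right, RCLike.conj_ofReal, sub_self]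

/-- Pairing with `derivVec` sends `f` to `(z f)'(p)`; a simple zero at `p` leaves one term, and a
double zero leaves none. -/
theorem inner_derivVec_blaschke (hp : |p| < 1) (x : Ell2 𝕜) :
    ⟪derivVec 𝕜 p, blaschke 𝕜 p x⟫_𝕜 = (p : 𝕜) * ⟪geomVec 𝕜 p, geom 𝕜 p x⟫_𝕜 := by
  rw [blaschke_apply, inner_sub_right, inner_shift_right, backwardShift_derivVec hp,
    inner_add_left, inner_smul_left, inner_smul_left, inner_smul_right, RCLike.conj_ofReal,
    add_sub_cancel_right]

theorem inner_derivVec_blaschke_blaschke (hp : |p| < 1) (x : Ell2 𝕜) :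
    ⟪derivVec 𝕜 p, blaschke 𝕜 p (blaschke 𝕜 p x)⟫_𝕜 = 0 := by
  rw [inner_derivVec_blaschke hp, geom_blaschke hp, inner_geomVec_blaschke hp, mul_zero]

theorem inner_kernelVec_blaschke_blaschke (hp : |p| < 1) (x : Ell2 𝕜) :
    ⟪kernelVec 𝕜 p, blaschke 𝕜 p (blaschke 𝕜 p x)⟫_𝕜 = 0 := by
  rw [kernelVec, inner_sub_left, inner_smul_left, inner_blaschke_blaschke hp,
    inner_geomVec_blaschke hp, inner_geomVec_blaschke hp, mul_zero, sub_zero]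

theorem inner_geomVec_geomVec (hp : |p| < 1) :
    ⟪geomVec 𝕜 p, geomVec 𝕜 p⟫_𝕜 = (1 - (p : 𝕜) ^ 2)⁻¹ := by
  have h : ⟪geomVec 𝕜 p, geomVec 𝕜 p⟫_𝕜 = 1 + (p : 𝕜) ^ 2 * ⟪geomVec 𝕜 p, geomVec 𝕜 p⟫_𝕜 := by
    conv_lhs => rw [geomVec_eq hp, inner_add_left, inner_stdVec, ← geomVec_eq hp,
      geomVec_apply hp, inner_smul_left, inner_shift_left, backwardShift_geomVec hp,
      inner_smul_right, RCLike.conj_ofReal]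
    ring
  refine eq_inv_of_mul_eq_one_left ?_
  linear_combination h

theorem inner_geomVec_derivVec (hp : |p| < 1) :
    ⟪geomVec 𝕜 p, derivVec 𝕜 p⟫_𝕜 = ((1 - (p : 𝕜) ^ 2) ^ 2)⁻¹ := by
  have h0 := one_sub_sq_ne_zero (𝕜 := 𝕜) hp
  have h : ⟪geomVec 𝕜 p, derivVec 𝕜 p⟫_𝕜 =
      (1 - (p : 𝕜) ^ 2)⁻¹ + (p : 𝕜) ^ 2 * ⟪geomVec 𝕜 p, derivVec 𝕜 p⟫_𝕜 := by
    conv_lhs => rw [derivVec_eq hp, inner_add_right, inner_geomVec_geomVec hp, inner_smul_right,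
      inner_shift_right, backwardShift_geomVec hp, inner_smul_left, RCLike.conj_ofReal]
    ring
  refine eq_inv_of_mul_eq_one_left ?_
  linear_combination (1 - (p : 𝕜) ^ 2) * h + inv_mul_cancel₀ h0

theorem inner_derivVec_geomVec (hp : |p| < 1) :
    ⟪derivVec 𝕜 p, geomVec 𝕜 p⟫_𝕜 = ((1 - (p : 𝕜) ^ 2) ^ 2)⁻¹ := by
  rw [← inner_conj_symm, inner_geomVec_derivVec hp]
  simp

theorem inner_derivVec_derivVec (hp : |p| < 1) :
    ⟪derivVec 𝕜 p, derivVec 𝕜 p⟫_𝕜 = (1 + (p : 𝕜) ^ 2) / (1 - (p : 𝕜) ^ 2) ^ 3 := by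
  have h0 := one_sub_sq_ne_zero (𝕜 := 𝕜) hp
  have h : ⟪derivVec 𝕜 p, derivVec 𝕜 p⟫_𝕜 = ((1 - (p : 𝕜) ^ 2) ^ 2)⁻¹ +
      (p : 𝕜) ^ 2 * (((1 - (p : 𝕜) ^ 2) ^ 2)⁻¹ + ⟪derivVec 𝕜 p, derivVec 𝕜 p⟫_𝕜) := by
    conv_lhs =>
      enter [3]
      rw [derivVec_eq hp]
    rw [inner_add_right, inner_derivVec_geomVec hp, inner_smul_right, inner_shift_right,
      backwardShift_derivVec hp, inner_add_left, inner_smul_left, inner_smul_left,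
      inner_geomVec_derivVec hp, RCLike.conj_ofReal]
    ring
  have h' : ((1 - (p : 𝕜) ^ 2) ^ 2)⁻¹ * (1 - (p : 𝕜) ^ 2) ^ 2 = 1 :=
    inv_mul_cancel₀ (pow_ne_zero 2 h0)
  rw [eq_div_iff (pow_ne_zero 3 h0)]
  linear_combination (1 - (p : 𝕜) ^ 2) ^ 2 * h + (1 + (p : 𝕜) ^ 2) * h'

theorem inner_derivVec_kernelVec (hp : |p| < 1) : ⟪derivVec 𝕜 p, kernelVec 𝕜 p⟫_𝕜 = 0 := by
  rw [kernelVec_eq, inner_sub_right, inner_sub_right, inner_shift_right,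
    backwardShift_derivVec hp, inner_add_left, inner_smul_left, inner_smul_left, inner_smul_right,
    inner_smul_right, inner_geomVec_derivVec hp, inner_derivVec_geomVec hp, RCLike.conj_ofReal]
  ring

theorem derivVec_ne_zero (hp : |p| < 1) : derivVec 𝕜 p ≠ 0 := fun h => by
  have := derivVec_apply (𝕜 := 𝕜) hp 0
  rw [h, zero_coord] at this
  simp at this

theorem kernelVec_ne_zero (hp : |p| < 1) : kernelVec 𝕜 p ≠ 0 := fun h => by
  have h1 : ⟪kernelVec 𝕜 p, kernelVec 𝕜 p⟫_𝕜 = (1 + (p : 𝕜) ^ 2) * (1 - (p : 𝕜) ^ 2)⁻¹ := by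
    rw [kernelVec, inner_sub_left, inner_sub_right, inner_sub_right, inner_blaschke_blaschke hp,
      inner_smul_left, inner_smul_left, inner_smul_right, inner_smul_right,
      inner_geomVec_blaschke hp, ← inner_conj_symm (blaschke 𝕜 p (geomVec 𝕜 p)),
      inner_geomVec_blaschke hp, inner_geomVec_geomVec hp, RCLike.conj_ofReal, map_zero]
    ring
  rw [h, inner_zero_left] at h1
  exact mul_ne_zero one_add_sq_ne_zero (inv_ne_zero (one_sub_sq_ne_zero hp)) h1.symm

theorem eq_smul_geomVec (hp : |p| < 1) {x : Ell2 𝕜} (hx : backwardShift 𝕜 x = (p : 𝕜) • x) :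
    x = x 0 • geomVec 𝕜 p := by
  refine ell2_ext fun n => ?_
  rw [smul_coord, geomVec_apply hp]
  induction n with
  | zero => simp
  | succ n ih =>
    rw [← backwardShift_apply, hx, smul_coord, ih]
    ring

/-- The only vector orthogonal to the eigenvectors of the Hessian operators is zero. -/
theorem eq_zero_of_orthogonal (hp : |p| < 1) {x : Ell2 𝕜} (h0 : ⟪derivVec 𝕜 p, x⟫_𝕜 = 0)
    (h1 : ⟪kernelVec 𝕜 p, x⟫_𝕜 = 0)
    (h2 : ∀ k, ⟪blaschke 𝕜 p (blaschke 𝕜 p (stdVec 𝕜 k)), x⟫_𝕜 = 0) : x = 0 := by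
  set c : 𝕜 := (p : 𝕜) with hc
  set V := blaschke 𝕜 p with hV
  have hVV : ContinuousLinearMap.adjoint V (ContinuousLinearMap.adjoint V x) = 0 := by
    refine ell2_ext fun k => ?_
    rw [← inner_stdVec, ContinuousLinearMap.adjoint_inner_right,
      ContinuousLinearMap.adjoint_inner_right, h2, zero_coord]
  have hVinv : ∀ z : Ell2 𝕜, V (z - c • shift 𝕜 z) = shift 𝕜 z - c • z := fun z => by
    have hz : geom 𝕜 p (z - c • shift 𝕜 z) = z := by
      rw [map_sub, map_smul, sub_eq_iff_eq_add]
      exact geom_eq' hp z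
    rw [hV, blaschke_apply, hz]
  -- The range of `V` contains the range of `S - p`, so the kernel of `V*` lies in that of `S* - p`.
  -- Used twice, this gives `(S* - p)² x = 0`.
  have hTz : ∀ z : Ell2 𝕜, ContinuousLinearMap.adjoint V z = 0 →
      backwardShift 𝕜 z = c • z := fun z hz => by
    refine ext_inner_left 𝕜 fun y => ?_
    have h : ⟪V (y - c • shift 𝕜 y), z⟫_𝕜 = 0 := by
      rw [← ContinuousLinearMap.adjoint_inner_right, hz, inner_zero_right]
    rw [hVinv, inner_sub_left, inner_smul_left, inner_shift_left, hc, RCLike.conj_ofReal] at h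
    rw [inner_smul_right]
    exact sub_eq_zero.1 h
  have hTT : backwardShift 𝕜 (backwardShift 𝕜 x - c • x) =
      c • (backwardShift 𝕜 x - c • x) := by
    refine hTz _ (ext_inner_left 𝕜 fun y => ?_)
    have h : ⟪V (V (y - c • shift 𝕜 y)), x⟫_𝕜 = 0 := by
      rw [← ContinuousLinearMap.adjoint_inner_right, ← ContinuousLinearMap.adjoint_inner_right,
        hVV, inner_zero_right]
    rw [hVinv, map_sub, map_smul, ← shift_blaschke hp, inner_sub_left, inner_shift_left,
      inner_smul_left, hc, RCLike.conj_ofReal] at h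
    rw [ContinuousLinearMap.adjoint_inner_right, inner_sub_right, inner_smul_right,
      inner_zero_right]
    exact h
  obtain ⟨b, hb⟩ : ∃ b : 𝕜, backwardShift 𝕜 x - c • x = b • geomVec 𝕜 p :=
    ⟨_, eq_smul_geomVec hp hTT⟩
  -- `S derivVec` is a particular solution of `(S* - p) y = geomVec`; the homogeneous solutions are
  -- the multiples of `geomVec`.
  obtain ⟨a, ha⟩ : ∃ a : 𝕜, x = a • geomVec 𝕜 p + b • shift 𝕜 (derivVec 𝕜 p) := by
    have h : backwardShift 𝕜 (x - b • shift 𝕜 (derivVec 𝕜 p)) =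
        c • (x - b • shift 𝕜 (derivVec 𝕜 p)) := by
      rw [map_sub, map_smul, backwardShift_shift, sub_eq_iff_eq_add.1 hb]
      conv_lhs => rw [derivVec_eq hp]
      module
    exact ⟨_, sub_eq_iff_eq_add.1 (eq_smul_geomVec hp h)⟩
  -- In terms of `u = geomVec` and `v = S derivVec`, the two spanning vectors are `u + c v` and `(1
  -- - c²) v - 2c u`; the coefficients solve this system, of determinant `1 + c²`.
  have hx : x = (((1 - c ^ 2) * a + 2 * c * b) / (1 + c ^ 2)) • derivVec 𝕜 p +
      ((b - c * a) / (1 + c ^ 2)) • kernelVec 𝕜 p := by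
    have hne : 1 + c ^ 2 ≠ 0 := one_add_sq_ne_zero
    rw [kernelVec_eq]
    conv_rhs =>
      enter [1]
      rw [derivVec_eq hp]
    conv_rhs =>
      enter [2, 2, 1, 2]
      rw [derivVec_eq hp]
    rw [ha]
    match_scalars <;> field_simp <;> ring
  have hxx : ⟪x, x⟫_𝕜 = 0 := by
    conv_lhs =>
      enter [2]
      rw [hx]
    rw [inner_add_left, inner_smul_left, inner_smul_left, h0, h1, mul_zero, mul_zero, add_zero]
  exact inner_self_eq_zero.1 hxx

end Geom

/-! ### Commutators with the weight `n + 1`, and the Hessian as a bounded operator minus the weight.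
-/

section Weight

variable {𝕜 : Type*} [RCLike 𝕜] {p : ℝ}

/-- `y` is the image of `x` under the unbounded operator of multiplication by `n + 1`. -/
def IsWeighted (x y : Ell2 𝕜) : Prop := ∀ n : ℕ, y n = ((n : 𝕜) + 1) * x n

namespace IsWeighted

variable {x y x' y' : Ell2 𝕜}

theorem sub (h : IsWeighted x y) (h' : IsWeighted x' y') : IsWeighted (x - x') (y - y') :=
  fun n => by rw [sub_coord, sub_coord, h, h']; ring

theorem smul (h : IsWeighted x y) (c : 𝕜) : IsWeighted (c • x) (c • y) :=
  fun n => by rw [smul_coord, smul_coord, h]; ring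

theorem inner_comm (h : IsWeighted x y) (h' : IsWeighted x' y') : ⟪y, x'⟫_𝕜 = ⟪x, y'⟫_𝕜 := by
  rw [lp.inner_eq_tsum, lp.inner_eq_tsum]
  congr 1
  funext n
  rw [h, h']
  simp only [RCLike.inner_apply, map_mul, map_add, map_natCast, map_one]
  ring

protected theorem shift (h : IsWeighted x y) :
    IsWeighted (shift 𝕜 x) (shift 𝕜 y + shift 𝕜 x) := fun n => by
  cases n with
  | zero => rw [add_coord, shift_zero, shift_zero, mul_zero, add_zero]
  | succ n =>
    rw [add_coord, shift_succ, shift_succ, h]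
    push_cast
    ring

/-- The commutator is the derivative `z d/dz` of `1/(1 - pz)`, namely `pz/(1 - pz)²`. The proof
compares coordinates through the recursions for both sides. -/
protected theorem geom (hp : |p| < 1) (h : IsWeighted x y) :
    IsWeighted (geom 𝕜 p x)
      (geom 𝕜 p y + (p : 𝕜) • shift 𝕜 (geom 𝕜 p (geom 𝕜 p x))) := by
  set g := geom 𝕜 p x with hg
  have hw : geom 𝕜 p y + (p : 𝕜) • shift 𝕜 (geom 𝕜 p g) =
      geom 𝕜 p (y + (p : 𝕜) • shift 𝕜 g) := by
    rw [map_add, map_smul, geom_shift hp]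
  rw [hw]
  set w := geom 𝕜 p (y + (p : 𝕜) • shift 𝕜 g) with hw'
  have hg1 : g = x + (p : 𝕜) • shift 𝕜 g := geom_eq hp x
  have hw1 : w = y + (p : 𝕜) • shift 𝕜 g + (p : 𝕜) • shift 𝕜 w := geom_eq hp _
  intro n
  induction n with
  | zero =>
    have hg0 : g 0 = x 0 + (p : 𝕜) * 0 := congrArg (fun z : Ell2 𝕜 => z 0) hg1
    have hw0 : w 0 = y 0 + (p : 𝕜) * 0 + (p : 𝕜) * 0 := congrArg (fun z : Ell2 𝕜 => z 0) hw1
    rw [hw0, hg0, h]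
    ring
  | succ n ih =>
    have hgn : g (n + 1) = x (n + 1) + (p : 𝕜) * g n :=
      congrArg (fun z : Ell2 𝕜 => z (n + 1)) hg1
    have hwn : w (n + 1) = y (n + 1) + (p : 𝕜) * g n + (p : 𝕜) * w n :=
      congrArg (fun z : Ell2 𝕜 => z (n + 1)) hw1
    rw [hwn, hgn, ih, h]
    push_cast
    ring

/-- The key identity `[N, V] = GV`: the commutator with the weight is reproduced by half of the
bounded term `2G`, which is why two factors of `V` are needed. -/
protected theorem blaschke (hp : |p| < 1) (h : IsWeighted x y) :
    IsWeighted (blaschke 𝕜 p x)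
      (blaschke 𝕜 p y + greenOp 𝕜 p (blaschke 𝕜 p x)) := by
  have hb := (h.geom hp).shift.sub ((h.geom hp).smul (p : 𝕜))
  rw [← blaschke_apply] at hb
  convert hb using 1
  have hgg : geom 𝕜 p (geom 𝕜 p x) =
      geom 𝕜 p x + (p : 𝕜) • shift 𝕜 (geom 𝕜 p (geom 𝕜 p x)) := geom_eq hp _
  have hS := congrArg (shift 𝕜) hgg
  rw [greenOp_blaschke hp, blaschke_apply]
  simp only [map_add, map_smul] at hS ⊢
  linear_combination (norm := module) hS

theorem stdVec (n : ℕ) : IsWeighted (stdVec 𝕜 n) (((n : 𝕜) + 1) • stdVec 𝕜 n) := fun j => by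
  rw [smul_coord, stdVec_apply]
  split_ifs with h
  · rw [h]
  · rw [mul_zero, mul_zero]

theorem blaschke_blaschke_stdVec (hp : |p| < 1) (k : ℕ) :
    IsWeighted (blaschke 𝕜 p (blaschke 𝕜 p (ConformalFlow.stdVec 𝕜 k)))
      (((k : 𝕜) + 1) • blaschke 𝕜 p (blaschke 𝕜 p (ConformalFlow.stdVec 𝕜 k)) +
        (2 : 𝕜) • greenOp 𝕜 p (blaschke 𝕜 p (blaschke 𝕜 p (ConformalFlow.stdVec 𝕜 k)))) := by
  convert ((stdVec (𝕜 := 𝕜) k).blaschke hp).blaschke hp using 1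
  rw [map_add, map_smul, map_smul, blaschke_greenOp_blaschke hp]
  module

theorem geomVec (hp : |p| < 1) : IsWeighted (ConformalFlow.geomVec 𝕜 p)
    (ConformalFlow.derivVec 𝕜 p) := fun n => by
  rw [derivVec_apply hp, geomVec_apply hp]

theorem derivVec (hp : |p| < 1) : IsWeighted (ConformalFlow.derivVec 𝕜 p)
    ((2 : 𝕜) • geom 𝕜 p (ConformalFlow.derivVec 𝕜 p) - ConformalFlow.derivVec 𝕜 p) := by
  convert (geomVec (𝕜 := 𝕜) hp).geom hp using 1
  · rfl
  have h := geom_eq hp (ConformalFlow.derivVec 𝕜 p)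
  have h' : geom 𝕜 p (ConformalFlow.geomVec 𝕜 p) = ConformalFlow.derivVec 𝕜 p := rfl
  rw [h']
  linear_combination (norm := module) h

theorem kernelVec (hp : |p| < 1) : IsWeighted (ConformalFlow.kernelVec 𝕜 p)
    ((2 : 𝕜) • shift 𝕜 (geom 𝕜 p (ConformalFlow.derivVec 𝕜 p)) -
      (2 * (p : 𝕜)) • geom 𝕜 p (ConformalFlow.derivVec 𝕜 p)) := by
  convert ((derivVec (𝕜 := 𝕜) hp).shift.sub ((derivVec hp).smul (p : 𝕜))).sub
    ((geomVec hp).smul (p : 𝕜)) using 1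
  · exact kernelVec_eq
  rw [map_sub, map_smul]
  module

end IsWeighted

theorem greenOp_geomVec (hp : |p| < 1) : greenOp 𝕜 p (geomVec 𝕜 p) = derivVec 𝕜 p := by
  have h := geomAdj_eq hp (geomVec 𝕜 p)
  rw [backwardShift_geomVec hp, map_smul] at h
  have h' : (1 - (p : 𝕜) ^ 2) • geomAdj 𝕜 p (geomVec 𝕜 p) = geomVec 𝕜 p := by
    linear_combination (norm := module) h
  -- `geomVec` is an eigenvector of the adjoint factor, with eigenvalue `1 / (1 - p²)`.
  rw [greenOp_apply, ← map_smul, h', derivVec]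

theorem greenOp_derivVec (hp : |p| < 1) :
    (1 - (p : 𝕜) ^ 2) • greenOp 𝕜 p (derivVec 𝕜 p) =
      (1 - (p : 𝕜) ^ 2) • geom 𝕜 p (derivVec 𝕜 p) + (p : 𝕜) ^ 2 • derivVec 𝕜 p := by
  have h := geomAdj_eq hp (derivVec 𝕜 p)
  rw [backwardShift_derivVec hp, map_add, map_smul, map_smul] at h
  have h' : (1 - (p : 𝕜) ^ 2) • geomAdj 𝕜 p (derivVec 𝕜 p) =
      derivVec 𝕜 p + (p : 𝕜) ^ 2 • geomAdj 𝕜 p (geomVec 𝕜 p) := by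
    linear_combination (norm := module) h
  have hu := greenOp_geomVec (𝕜 := 𝕜) hp
  rw [greenOp_apply] at hu
  rw [greenOp_apply, ← map_smul, h', map_add, map_smul, smul_add]
  linear_combination (norm := module) (p : 𝕜) ^ 2 • hu

theorem greenOp_kernelVec (hp : |p| < 1) : (2 : 𝕜) • greenOp 𝕜 p (kernelVec 𝕜 p) =
    (2 : 𝕜) • shift 𝕜 (geom 𝕜 p (derivVec 𝕜 p)) -
      (2 * (p : 𝕜)) • geom 𝕜 p (derivVec 𝕜 p) := by
  have h1 : greenOp 𝕜 p (shift 𝕜 (derivVec 𝕜 p)) =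
      (1 - (p : 𝕜) ^ 2) • shift 𝕜 (geom 𝕜 p (derivVec 𝕜 p)) +
        (p : 𝕜) • greenOp 𝕜 p (derivVec 𝕜 p) := by
    rw [greenOp_apply, greenOp_apply, geomAdj_shift hp, map_add, map_smul, geom_shift hp]
    module
  rw [kernelVec_eq, map_sub, map_sub, map_smul, map_smul, h1, greenOp_geomVec hp]
  linear_combination (norm := module) (2 * (p : 𝕜)) • geom_eq hp (derivVec 𝕜 p)

/-- The bounded part of the Hessian operators at the ground state. -/
def boundedHessian (𝕜 : Type*) [RCLike 𝕜] (s : ℤˣ) (p : ℝ) : Ell2 𝕜 →L[𝕜] Ell2 𝕜 :=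
  (2 : 𝕜) • greenOp 𝕜 p + ((((s : ℤ) : ℝ) * (1 - p ^ 2) ^ 2 : ℝ) : 𝕜) •
    (innerSL 𝕜 (derivVec 𝕜 p)).smulRight (derivVec 𝕜 p)

theorem boundedHessian_apply (s : ℤˣ) (x : Ell2 𝕜) : boundedHessian 𝕜 s p x =
    (2 : 𝕜) • greenOp 𝕜 p x + ((((s : ℤ) : ℝ) * (1 - p ^ 2) ^ 2 : ℝ) : 𝕜) •
      ⟪derivVec 𝕜 p, x⟫_𝕜 • derivVec 𝕜 p := rfl

theorem inner_boundedHessian_left (s : ℤˣ) (x y : Ell2 𝕜) :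
    ⟪boundedHessian 𝕜 s p x, y⟫_𝕜 = ⟪x, boundedHessian 𝕜 s p y⟫_𝕜 := by
  simp only [boundedHessian_apply, inner_add_left, inner_add_right, inner_smul_left,
    inner_smul_right, inner_greenOp_left, inner_conj_symm, RCLike.conj_ofReal, map_ofNat]
  ring

theorem geom_stdVec_apply (hp : |p| < 1) (n j : ℕ) :
    geom 𝕜 p (stdVec 𝕜 n) j = if n ≤ j then (p : 𝕜) ^ (j - n) else 0 := by
  induction n generalizing j with
  | zero => exact (geomVec_apply hp j).trans (by simp)
  | succ n ih =>
    rw [← shift_stdVec, geom_shift hp]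
    cases j with
    | zero => rw [shift_zero, if_neg (by omega)]
    | succ j => simp [shift_succ, ih]

theorem greenOp_stdVec_apply (hp : |p| < 1) (n j : ℕ) :
    greenOp 𝕜 p (stdVec 𝕜 n) j =
      (p : 𝕜) ^ ((n : ℤ) - (j : ℤ)).natAbs - (p : 𝕜) ^ (2 + n + j) := by
  induction n with
  | zero =>
    rw [greenOp_apply, geomAdj_eq hp, backwardShift_stdVec_zero, map_zero, smul_zero, add_zero,
      smul_coord, geom_stdVec_apply hp, if_pos (by omega),
      show ((0 : ℕ) - (j : ℤ)).natAbs = j by omega, Nat.sub_zero]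
    ring
  | succ n ih =>
    -- The recursion for the adjoint factor expresses each column of the matrix through the
    -- preceding one.
    have h : greenOp 𝕜 p (stdVec 𝕜 (n + 1)) =
        (1 - (p : 𝕜) ^ 2) • geom 𝕜 p (stdVec 𝕜 (n + 1)) +
          (p : 𝕜) • greenOp 𝕜 p (stdVec 𝕜 n) := by
      rw [greenOp_apply, greenOp_apply, geomAdj_eq hp, backwardShift_stdVec_succ, map_add,
        map_smul]
      module
    rw [h, add_coord, smul_coord, smul_coord, ih, geom_stdVec_apply hp]
    split_ifs with hj
    · obtain ⟨d, rfl⟩ := Nat.exists_eq_add_of_le hj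
      rw [show ((n : ℤ) - ((n + 1 + d : ℕ) : ℤ)).natAbs = d + 1 by omega,
        show (((n + 1 : ℕ) : ℤ) - ((n + 1 + d : ℕ) : ℤ)).natAbs = d by omega,
        show n + 1 + d - (n + 1) = d by omega]
      ring
    · rw [show (((n + 1 : ℕ) : ℤ) - (j : ℤ)).natAbs = ((n : ℤ) - (j : ℤ)).natAbs + 1 by omega]
      ring

theorem boundedHessian_stdVec_apply (hp0 : 0 ≤ p) (hp1 : p < 1) (s : ℤˣ) (n j : ℕ) :
    boundedHessian 𝕜 s p (stdVec 𝕜 n) j = (hessianEntry s (groundState p) n j : 𝕜) := by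
  have hp : |p| < 1 := abs_lt.2 ⟨by linarith, hp1⟩
  rw [hessianEntry_groundState hp0 hp1, boundedHessian_apply, add_coord, smul_coord, smul_coord,
    smul_coord, greenOp_stdVec_apply hp, derivVec_apply hp, ← inner_conj_symm, inner_stdVec,
    derivVec_apply hp]
  simp only [map_mul, map_add, map_pow, map_natCast, map_one, RCLike.conj_ofReal, map_sub,
    RCLike.ofReal_ofNat]
  ring

theorem hasSum_hessianEntry (hp0 : 0 ≤ p) (hp1 : p < 1) (s : ℤˣ) (x : Ell2 𝕜) (n : ℕ) :
    HasSum (fun j => (hessianEntry s (groundState p) n j : 𝕜) * x j)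
      (boundedHessian 𝕜 s p x n) := by
  have h := lp.hasSum_inner (𝕜 := 𝕜) (boundedHessian 𝕜 s p (stdVec 𝕜 n)) x
  rw [inner_boundedHessian_left, inner_stdVec] at h
  refine h.congr_fun fun j => ?_
  rw [boundedHessian_stdVec_apply hp0 hp1, RCLike.inner_apply, RCLike.conj_ofReal, mul_comm]

theorem hessianAction_groundState (hp0 : 0 ≤ p) (hp1 : p < 1) (s : ℤˣ) (x : Ell2 𝕜) (n : ℕ) :
    hessianAction s (groundState p) 1 (x : ℕ → 𝕜) n =
      boundedHessian 𝕜 s p x n - ((n : 𝕜) + 1) * x n := by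
  rw [hessianAction, (hasSum_hessianEntry hp0 hp1 s x n).tsum_eq, RCLike.ofReal_one, mul_one]

/-- As `B±` is bounded, `L± x = y` means `N x = B± x - y`; the domain condition is absorbed by the
right-hand side being in `ℓ²`. -/
theorem groundHessian_apply_eq_iff (hp0 : 0 ≤ p) (hp1 : p < 1) (s : ℤˣ) (x y : Ell2 𝕜) :
    (∃ h : x ∈ (groundHessian 𝕜 s p).domain, groundHessian 𝕜 s p ⟨x, h⟩ = y) ↔
      IsWeighted x (boundedHessian 𝕜 s p x - y) := by
  constructor
  · rintro ⟨h, rfl⟩ n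
    rw [sub_coord]
    change _ - hessianAction s (groundState p) 1 (x : ℕ → 𝕜) n = _
    rw [hessianAction_groundState hp0 hp1]
    ring
  · intro h
    have hact : hessianAction s (groundState p) 1 (x : ℕ → 𝕜) = y := by
      funext n
      rw [hessianAction_groundState hp0 hp1, ← h n, sub_coord]
      ring
    refine ⟨⟨fun n => (hasSum_hessianEntry hp0 hp1 s x n).summable, ?_⟩, ?_⟩
    · rw [hact]
      exact lp.memℓp y
    · exact lp.ext hact

theorem groundHessian_domain (hp0 : 0 ≤ p) (hp1 : p < 1) (s : ℤˣ) :
    ((groundHessian 𝕜 s p).domain : Set (Ell2 𝕜)) = weightedSpace 𝕜 1 := by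
  ext x
  have hiff : x ∈ weightedSpace 𝕜 1 ↔ Memℓp (fun n : ℕ => ((n : 𝕜) + 1) * x n) 2 := by
    rw [memℓp_gen_iff (by norm_num)]
    refine summable_congr fun n => ?_
    have hn : ‖(n : 𝕜) + 1‖ = (n : ℝ) + 1 := by
      rw [← Nat.cast_add_one, RCLike.norm_natCast, Nat.cast_add_one]
    rw [norm_mul, hn, show (2 : ENNReal).toReal = 2 by simp, mul_one,
      Real.mul_rpow (by positivity) (norm_nonneg _), Real.rpow_two ‖x n‖]
  rw [hiff]
  constructor
  · intro hx
    have h := (groundHessian_apply_eq_iff hp0 hp1 s x _).1 ⟨hx, rfl⟩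
    have h' : (fun n : ℕ => ((n : 𝕜) + 1) * x n) =
        (boundedHessian 𝕜 s p x - groundHessian 𝕜 s p ⟨x, hx⟩ : Ell2 𝕜) :=
      funext fun n => (h n).symm
    rw [h']
    exact lp.memℓp _
  · intro hx
    refine ((groundHessian_apply_eq_iff hp0 hp1 s x
      (boundedHessian 𝕜 s p x - ⟨_, hx⟩)).2 fun n => ?_).1
    rw [sub_sub_cancel]

end Weight

/-! ### The common orthogonal eigenbasis. -/

section Eigenbasis

variable (𝕜 : Type*) [RCLike 𝕜] (p : ℝ)

/-- The eigenvectors of the Hessian operators at the ground state. -/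
def eigenvector : ℕ → Ell2 𝕜
  | 0 => derivVec 𝕜 p
  | 1 => kernelVec 𝕜 p
  | k + 2 => blaschke 𝕜 p (blaschke 𝕜 p (stdVec 𝕜 k))

/-- The eigenvalues of the Hessian operators at the ground state. -/
def groundEigenvalue (s : ℤˣ) : ℕ → ℝ
  | 0 => (1 + ((s : ℤ) : ℝ)) * (1 + p ^ 2) / (1 - p ^ 2)
  | k + 1 => -(k : ℝ)

variable {𝕜 p}

theorem isWeighted_eigenvector (hp : |p| < 1) (s : ℤˣ) (i : ℕ) :
    IsWeighted (eigenvector 𝕜 p i) (boundedHessian 𝕜 s p (eigenvector 𝕜 p i) -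
      (groundEigenvalue p s i : 𝕜) • eigenvector 𝕜 p i) := by
  have h0 : (1 - (p : 𝕜) ^ 2) ≠ 0 := one_sub_sq_ne_zero hp
  match i with
  | 0 =>
    have h : boundedHessian 𝕜 s p (derivVec 𝕜 p) -
        (((1 + ((s : ℤ) : ℝ)) * (1 + p ^ 2) / (1 - p ^ 2) : ℝ) : 𝕜) • derivVec 𝕜 p =
          (2 : 𝕜) • geom 𝕜 p (derivVec 𝕜 p) - derivVec 𝕜 p := by
      have h := congrArg (fun x => (1 - (p : 𝕜) ^ 2)⁻¹ • x) (greenOp_derivVec (𝕜 := 𝕜) hp)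
      simp only [smul_add, inv_smul_smul₀ h0] at h
      -- The squared norm of `derivVec` makes the rank-one term equal to `s` times the eigenvalue of
      -- `2G - N`, whence the factor `1 + s`.
      rw [boundedHessian_apply, inner_derivVec_derivVec hp, h]
      simp only [RCLike.ofReal_add, RCLike.ofReal_sub, RCLike.ofReal_mul, RCLike.ofReal_div,
        RCLike.ofReal_pow, RCLike.ofReal_one]
      match_scalars <;> field_simp <;> ring
    have hw := IsWeighted.derivVec (𝕜 := 𝕜) hp
    rw [← h] at hw
    exact hw
  | 1 =>
    have h : boundedHessian 𝕜 s p (kernelVec 𝕜 p) -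
        ((-((0 : ℕ) : ℝ) : ℝ) : 𝕜) • kernelVec 𝕜 p =
          (2 : 𝕜) • shift 𝕜 (geom 𝕜 p (derivVec 𝕜 p)) -
            (2 * (p : 𝕜)) • geom 𝕜 p (derivVec 𝕜 p) := by
      rw [boundedHessian_apply, inner_derivVec_kernelVec hp, greenOp_kernelVec hp]
      simp
    have hw := IsWeighted.kernelVec (𝕜 := 𝕜) hp
    rw [← h] at hw
    exact hw
  | k + 2 =>
    have h : ∀ x : Ell2 𝕜, boundedHessian 𝕜 s p (blaschke 𝕜 p (blaschke 𝕜 p x)) -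
        ((-((k + 1 : ℕ) : ℝ) : ℝ) : 𝕜) • blaschke 𝕜 p (blaschke 𝕜 p x) =
          ((k : 𝕜) + 1) • blaschke 𝕜 p (blaschke 𝕜 p x) +
            (2 : 𝕜) • greenOp 𝕜 p (blaschke 𝕜 p (blaschke 𝕜 p x)) := fun x => by
      rw [boundedHessian_apply, inner_derivVec_blaschke_blaschke hp]
      simp only [RCLike.ofReal_neg, RCLike.ofReal_natCast, Nat.cast_add, Nat.cast_one,
        RCLike.ofReal_add, RCLike.ofReal_one]
      module
    have hw := IsWeighted.blaschke_blaschke_stdVec (𝕜 := 𝕜) hp k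
    rw [← h] at hw
    exact hw

theorem eigenvector_ne_zero (hp : |p| < 1) (i : ℕ) : eigenvector 𝕜 p i ≠ 0 := by
  match i with
  | 0 => exact derivVec_ne_zero hp
  | 1 => exact kernelVec_ne_zero hp
  | k + 2 =>
    rw [eigenvector, Ne, ← inner_self_eq_zero (𝕜 := 𝕜), inner_blaschke_blaschke hp,
      inner_blaschke_blaschke hp, inner_stdVec, stdVec_apply]
    simp

theorem inner_eigenvector_of_lt (hp : |p| < 1) {i j : ℕ} (hij : i < j) :
    ⟪eigenvector 𝕜 p i, eigenvector 𝕜 p j⟫_𝕜 = 0 := by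
  match i, j with
  | 0, 1 => exact inner_derivVec_kernelVec hp
  | 0, k + 2 => exact inner_derivVec_blaschke_blaschke hp _
  | 1, k + 2 => exact inner_kernelVec_blaschke_blaschke hp _
  | i + 2, j + 2 =>
    rw [eigenvector, eigenvector, inner_blaschke_blaschke hp, inner_blaschke_blaschke hp,
      inner_stdVec, stdVec_apply, if_neg (by omega)]

theorem inner_eigenvector_of_ne (hp : |p| < 1) {i j : ℕ} (hij : i ≠ j) :
    ⟪eigenvector 𝕜 p i, eigenvector 𝕜 p j⟫_𝕜 = 0 := by
  rcases hij.lt_or_gt with h | h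
  · exact inner_eigenvector_of_lt hp h
  · exact inner_eq_zero_symm.1 (inner_eigenvector_of_lt hp h)

/-- The normalized eigenvectors form a Hilbert basis. -/
theorem exists_hilbertBasis_eigenvector (hp : |p| < 1) : ∃ b : HilbertBasis ℕ 𝕜 (Ell2 𝕜),
    ∀ i, b i = ((‖eigenvector 𝕜 p i‖⁻¹ : ℝ) : 𝕜) • eigenvector 𝕜 p i := by
  let f : ℕ → Ell2 𝕜 := fun i => ((‖eigenvector 𝕜 p i‖⁻¹ : ℝ) : 𝕜) • eigenvector 𝕜 p i
  have hf : Orthonormal 𝕜 f := by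
    refine ⟨fun i => ?_, fun i j hij => ?_⟩
    · simp only [f, norm_smul, RCLike.norm_ofReal, abs_inv, abs_norm]
      exact inv_mul_cancel₀ (norm_ne_zero_iff.2 (eigenvector_ne_zero hp i))
    · simp only [f, inner_smul_left, inner_smul_right, inner_eigenvector_of_ne hp hij, mul_zero]
  have hbot : (Submodule.span 𝕜 (Set.range f))ᗮ = ⊥ := by
    refine (Submodule.eq_bot_iff _).2 fun x hx => ?_
    have h : ∀ i, ⟪eigenvector 𝕜 p i, x⟫_𝕜 = 0 := fun i => by
      have hi := (Submodule.mem_orthogonal _ _).1 hx _ (Submodule.subset_span ⟨i, rfl⟩)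
      rw [inner_smul_left, RCLike.conj_ofReal] at hi
      refine (mul_eq_zero.1 hi).resolve_left ?_
      exact RCLike.ofReal_ne_zero.2
        (inv_ne_zero (norm_ne_zero_iff.2 (eigenvector_ne_zero hp i)))
    exact eq_zero_of_orthogonal hp (h 0) (h 1) fun k => h (k + 2)
  exact ⟨HilbertBasis.mkOfOrthogonalEqBot hf hbot, fun i => by
    rw [HilbertBasis.coe_mkOfOrthogonalEqBot]⟩

/-- The Hessian operators at the ground state are diagonal in a common Hilbert basis. -/
theorem exists_isDiagonal_groundHessian (𝕜 : Type*) [RCLike 𝕜] (hp0 : 0 ≤ p) (hp1 : p < 1)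
    (s : ℤˣ) : ∃ b : HilbertBasis ℕ 𝕜 (Ell2 𝕜),
      IsDiagonal (groundHessian 𝕜 s p) b (groundEigenvalue p s) := by
  have hp : |p| < 1 := abs_lt.2 ⟨by linarith, hp1⟩
  obtain ⟨b, hb⟩ := exists_hilbertBasis_eigenvector (𝕜 := 𝕜) hp
  have hbw : ∀ i, IsWeighted (b i)
      (boundedHessian 𝕜 s p (b i) - (groundEigenvalue p s i : 𝕜) • b i) := fun i => by
    rw [hb, map_smul, smul_comm, ← smul_sub]
    exact (isWeighted_eigenvector hp s i).smul _
  refine ⟨b, fun x y => ?_⟩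
  rw [groundHessian_apply_eq_iff hp0 hp1]
  constructor
  · intro h i
    have hi := (hbw i).inner_comm h
    rw [inner_sub_left, inner_sub_right, inner_boundedHessian_left, inner_smul_left,
      RCLike.conj_ofReal] at hi
    exact (sub_right_injective hi).symm
  · intro h n
    -- `r` is the image of the standard vector under the Hessian. Expanding `⟪r, x⟫` in the
    -- eigenbasis recovers coordinate `n` of the equation for `x` and `y`.
    set r : Ell2 𝕜 := boundedHessian 𝕜 s p (stdVec 𝕜 n) - ((n : 𝕜) + 1) • stdVec 𝕜 n with hr
    have hrb : ∀ i, ⟪r, b i⟫_𝕜 = (groundEigenvalue p s i : 𝕜) * ⟪stdVec 𝕜 n, b i⟫_𝕜 := by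
      intro i
      have hi := hbw i n
      rw [sub_coord, smul_coord] at hi
      rw [hr, inner_sub_left, inner_boundedHessian_left, inner_smul_left, inner_stdVec,
        inner_stdVec, map_add, map_natCast, map_one, ← hi]
      ring
    have hry : ⟪r, x⟫_𝕜 = ⟪stdVec 𝕜 n, y⟫_𝕜 := by
      rw [← b.tsum_inner_mul_inner, ← b.tsum_inner_mul_inner]
      congr 1
      funext i
      rw [hrb, h]
      ring
    rw [hr, inner_sub_left, inner_boundedHessian_left, inner_smul_left, inner_stdVec,
      inner_stdVec, inner_stdVec, map_add, map_natCast, map_one] at hry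
    rw [sub_coord, ← hry]
    ring

theorem tendsto_abs_groundEigenvalue (s : ℤˣ) :
    Tendsto (fun i => |groundEigenvalue p s i|) cofinite atTop := by
  rw [Nat.cofinite_eq_atTop, ← tendsto_add_atTop_iff_nat 1]
  simp only [groundEigenvalue, abs_neg, Nat.abs_cast]
  exact tendsto_natCast_atTop_atTop

/-- An upper bound common to both signs, so that `λ_* + 1` lies in both resolvent sets. -/
theorem groundEigenvalue_le (s : ℤˣ) (hp : |p| < 1) (i : ℕ) :
    groundEigenvalue p s i ≤ 2 * (1 + p ^ 2) / (1 - p ^ 2) := by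
  have h0 : 0 < 1 - p ^ 2 := by
    have := (sq_lt_one_iff_abs_lt_one p).2 hp
    linarith
  cases i with
  | zero =>
    rw [groundEigenvalue]
    rcases Int.units_eq_one_or s with rfl | rfl
    · norm_num
    · norm_num
      positivity
  | succ k =>
    rw [groundEigenvalue]
    have : 0 ≤ 2 * (1 + p ^ 2) / (1 - p ^ 2) := by positivity
    have : (0 : ℝ) ≤ k := Nat.cast_nonneg k
    linarith

end Eigenbasis

end ConformalFlow

end

/-! ### Reading the statement off the diagonal. -/

theorem mainTheorem5 (𝕜 : Type*) [RCLike 𝕜] (p : ℝ) (hp0 : 0 ≤ p) (hp1 : p < 1) :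
    -- both operators `L₊(p)` (`s = 1`) and `L₋(p)` (`s = -1`)
    (∀ s : ℤˣ,
      (∀ n j : ℕ, ConformalFlow.hessianEntry s (ConformalFlow.groundState p) n j =
        2 * p ^ ((n : ℤ) - (j : ℤ)).natAbs - 2 * p ^ (2 + n + j) +
          ((s : ℤ) : ℝ) * ((1 - p ^ 2) ^ 2 * ((j : ℝ) + 1) * ((n : ℝ) + 1) * p ^ (n + j))) ∧
      ((ConformalFlow.groundHessian 𝕜 s p).domain : Set (ConformalFlow.Ell2 𝕜)) =
        ConformalFlow.weightedSpace 𝕜 1 ∧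
      IsSelfAdjoint (ConformalFlow.groundHessian 𝕜 s p) ∧
      ConformalFlow.HasCompactResolvent (ConformalFlow.groundHessian 𝕜 s p) ∧
      (∀ z ∈ ConformalFlow.unboundedSpectrum (ConformalFlow.groundHessian 𝕜 s p), ∃ ε > 0,
        ConformalFlow.unboundedSpectrum (ConformalFlow.groundHessian 𝕜 s p) ∩
          Metric.ball z ε = {z})) ∧
    -- the spectrum of `L₋(p)`, with multiplicities
    (ConformalFlow.unboundedSpectrum (ConformalFlow.groundHessian 𝕜 (-1) p) =
        Set.range (fun m : ℕ => -(m : 𝕜)) ∧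
      Module.finrank 𝕜
        (ConformalFlow.unboundedEigenspace (ConformalFlow.groundHessian 𝕜 (-1) p) 0) = 2 ∧
      ∀ m : ℕ, 1 ≤ m → Module.finrank 𝕜
        (ConformalFlow.unboundedEigenspace (ConformalFlow.groundHessian 𝕜 (-1) p) (-(m : 𝕜))) = 1) ∧
    -- the spectrum of `L₊(p)`, with multiplicities
    (0 < 2 * (1 + p ^ 2) / (1 - p ^ 2) ∧
      ConformalFlow.unboundedSpectrum (ConformalFlow.groundHessian 𝕜 1 p) =
        insert ((2 * (1 + p ^ 2) / (1 - p ^ 2) : ℝ) : 𝕜) (Set.range (fun m : ℕ => -(m : 𝕜))) ∧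
      Module.finrank 𝕜
        (ConformalFlow.unboundedEigenspace (ConformalFlow.groundHessian 𝕜 1 p)
          ((2 * (1 + p ^ 2) / (1 - p ^ 2) : ℝ) : 𝕜)) = 1 ∧
      ∀ m : ℕ, Module.finrank 𝕜
        (ConformalFlow.unboundedEigenspace (ConformalFlow.groundHessian 𝕜 1 p) (-(m : 𝕜))) = 1) := by

  have hp : |p| < 1 := abs_lt.2 ⟨by linarith, hp1⟩
  have hpos : (0 : ℝ) < 2 * (1 + p ^ 2) / (1 - p ^ 2) := by
    have : 0 < 1 - p ^ 2 := by nlinarith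
    positivity
  have hspec := fun s : ℤˣ => ConformalFlow.exists_isDiagonal_groundHessian 𝕜 hp0 hp1 s
  have hd := fun s : ℤˣ => ConformalFlow.tendsto_abs_groundEigenvalue (p := p) s
  have hcast : ∀ m : ℕ, (-(m : 𝕜)) = ((-(m : ℝ) : ℝ) : 𝕜) := fun m => by simp
  have hzero : ConformalFlow.groundEigenvalue p (-1) 0 = 0 := by
    simp [ConformalFlow.groundEigenvalue]
  have hlam : ConformalFlow.groundEigenvalue p 1 0 = 2 * (1 + p ^ 2) / (1 - p ^ 2) := by
    simp only [ConformalFlow.groundEigenvalue, Units.val_one, Int.cast_one]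
    norm_num
  refine ⟨fun s => ?_, ?_, hpos, ?_⟩
  · obtain ⟨b, hL⟩ := hspec s
    refine ⟨ConformalFlow.hessianEntry_groundState hp0 hp1 s,
      ConformalFlow.groundHessian_domain hp0 hp1 s, hL.isSelfAdjoint,
      hL.hasCompactResolvent (hd s)
        (z := ((2 * (1 + p ^ 2) / (1 - p ^ 2) + 1 : ℝ) : 𝕜)) fun i h => ?_,
      fun z hz => hL.exists_inter_ball_eq_singleton (hd s) hz⟩
    have := ConformalFlow.groundEigenvalue_le s hp i
    rw [RCLike.ofReal_inj.1 h] at this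
    linarith
  · obtain ⟨b, hL⟩ := hspec (-1)
    refine ⟨?_, ?_, fun m hm => ?_⟩
    · rw [hL.unboundedSpectrum_eq (hd _)]
      ext z
      constructor
      · rintro ⟨_ | k, rfl⟩
        · exact ⟨0, by simp [hzero]⟩
        · exact ⟨k, by simp [ConformalFlow.groundEigenvalue]⟩
      · rintro ⟨k, rfl⟩
        exact ⟨k + 1, by simp [ConformalFlow.groundEigenvalue]⟩
    -- For `L₋` the eigenvalue at index `0` collapses to `0` and joins that at index `1`; for `m ≥
    -- 1`, `-m` occurs only at index `m + 1`.
    · rw [hL.finrank_unboundedEigenspace 0 {0, 1}]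
      · rfl
      · intro i
        rw [RCLike.ofReal_eq_zero]
        rcases i with _ | _ | k
        · simp [hzero]
        · simp [ConformalFlow.groundEigenvalue]
        · have : -((k : ℝ) + 1) ≠ 0 := neg_ne_zero.2 (Nat.cast_add_one_ne_zero k)
          simpa [ConformalFlow.groundEigenvalue] using this
    · rw [hL.finrank_unboundedEigenspace _ {m + 1}, Finset.card_singleton]
      intro i
      rw [hcast, RCLike.ofReal_inj, Finset.mem_singleton]
      cases i with
      | zero =>
        rw [hzero]
        have : (m : ℝ) ≠ 0 := Nat.cast_ne_zero.2 (by omega)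
        simpa [eq_comm] using this
      | succ k => simp [ConformalFlow.groundEigenvalue]
  · obtain ⟨b, hL⟩ := hspec 1
    refine ⟨?_, ?_, fun m => ?_⟩
    · rw [hL.unboundedSpectrum_eq (hd _)]
      ext z
      constructor
      · rintro ⟨_ | k, rfl⟩
        · exact Or.inl (by simp only [hlam])
        · exact Or.inr ⟨k, by simp [ConformalFlow.groundEigenvalue]⟩
      · rintro (rfl | ⟨k, rfl⟩)
        · exact ⟨0, by simp only [hlam]⟩
        · exact ⟨k + 1, by simp [ConformalFlow.groundEigenvalue]⟩
    · rw [hL.finrank_unboundedEigenspace _ {0}, Finset.card_singleton]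
      intro i
      rw [RCLike.ofReal_inj, Finset.mem_singleton]
      cases i with
      | zero => simp only [hlam]
      | succ k =>
        have h : ConformalFlow.groundEigenvalue p 1 (k + 1) ≤ 0 :=
          neg_nonpos.2 (Nat.cast_nonneg k)
        exact ⟨fun h' => absurd h' (by omega), fun h' => by rw [h'] at h; linarith⟩
    · rw [hL.finrank_unboundedEigenspace _ {m + 1}, Finset.card_singleton]
      intro i
      rw [hcast, RCLike.ofReal_inj, Finset.mem_singleton]
      cases i with
      | zero =>
        rw [hlam]
        have : (0 : ℝ) ≤ m := Nat.cast_nonneg m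
        exact ⟨fun h' => absurd h' (by omega), fun h' => by linarith⟩
      | succ k => simp [ConformalFlow.groundEigenvalue]
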